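/- **Setting.** Let $N=\mathbb Z^2$, $M=\mathrm{Hom}(N,\mathbb Z)$, $N_{\mathbb R}=N\otimes\mathbb R$, and let $\omega$ be the standard area form on $N$. Let $n_1,\dots,n_r$ and $n$ be primitive vectors of $N$ and $s\ge 0$, with $\sum_j n_j+2s\,n=0$. Put $$\Delta=\{n_1,\dots,n_r,n^{2s}\},\qquad \Delta(s)=\{n_1,\dots,n_r,(2n)^{s}\}.$$ *Tropical curves.* A rational parametrized tropical curve $h:\Gamma\to N_{\mathbb R}$ is a finite metric tree $\Gamma$ with unbounded ends, all of whose finite vertices have valence at least $3$, with a map $h$ that is affine with slopes in $N$ on the edges and is balanced at each vertex. Its degree is the multiset of the slopes of its ends, oriented to infinity. The moment of an end of slope $n_e$ is $\omega(n_e,p)$, for any $p$ in its image. A vertex is flat if all outgoing slopes are parallel. A real parametrized tropical curve $(\Gamma,\sigma,h)$ has in addition an involutive isometry $\sigma$ of $\Gamma$ with $h\circ\sigma=h$. Isomorphisms are isometries that commute with $h$ and $\sigma$. A double end is an end not fixed by $\sigma$. *Splitting.* Let $\Gamma_0$ be a rational parametrized tropical curve. $\Gamma_{0,\mathrm{even}}$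 is the smallest subgraph of $\Gamma_0$ that contains all ends of even slope and, whenever it contains all edges adjacent to a vertex but one, also the remaining one. A real curve $(\Gamma,\sigma,h)$ is obtained by splitting $\Gamma_0$ if there is a map $\pi:\Gamma\to\Gamma_0$ with $h=h_0\circ\pi$ whose fibres are the orbits of $\sigma$, such that lengths and slopes are unchanged on edges fixed by $\sigma$, while an exchanged edge has twice the length and half the slope of its image. The splitting graph is the set of points of $\Gamma_0$ with two preimages. It is maximal if its closure is $\Gamma_{0,\mathrm{even}}$. *Real curves through a symmetric configuration.* A configuration $\mathcal P_t$ consists of series $\zeta_1,\dots,\zeta_r\in\mathbb R((t))^*$ and $\xi_1,\dots,\xi_s\in i\mathbb R((t))^*$ with $\prod_j\zeta_j\prod_k\xi_k^2=\pm1$. They are the coordinates, up to sign, of pairs $\pm p_j$ on the toric divisors of directions $n_j$, and of pairs of conjugated points $\pm q_k$ on the divisor of direction $n$. Its tropical moments $\mu\in\mathbb R^{r+s}$ are $\mathrm{val}\,\zeta_j$ and $2\,\mathrm{val}\,\xi_k$. A real rational curve is $f(y)=\chi\prod_i(y-\alpha_i)^{\nu_i}\in\mathrm{Hom}(M,\mathbb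 C((t))^*)$ with $\chi$ real and distinct marked points $\alpha_i\in\mathbb C((t))$ that are real or come in conjugated pairs with equal exponents. Its moment at $\alpha_i$ is the value of $f^*\chi^{\omega(\nu_i,\cdot)}$ at $\alpha_i$. It passes through $\mathcal P_t$ if for every $j$ some $\alpha_i$ with $\nu_i=n_j$ has moment $\pm\zeta_j$, and for every $k$ some $\alpha_i$ with $\nu_i=n$ has moment $\pm\xi_k$. Its tropicalization is the dual metric tree of the stable model of the marked curve, mapped by the order of $f$ along the components of the special fibre, with the involution induced by complex conjugation. **Lemma.** There are finitely many proper hyperplanes of $\{\mu\in\mathbb R^{r+s}:\sum_i\mu_i=0\}$, depending only on $n_1,\dots,n_r,n,s$, such that the following holds for every configuration $\mathcal P_t$ whose vector $\mu$ of tropical moments lies on none of them. Let $h_0:\Gamma_0\to N_{\mathbb R}$ be a rational parametrized tropical curve of degree $\Delta(s)$ with ends of moments $\mu$, and let $C_{\rm trop}=h_0(\Gamma_0)$. 1. $\Gamma_{0,\mathrm{even}}$ consists exactly of the $s$ ends of slope $2n$. 2. Up to isomorphism there is at most one real rational parametrized tropical curve $(\Gamma,\sigma,h)$ of degree $\Delta$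 with $h(\Gamma)=C_{\rm trop}$ that is the tropicalization of a real rational curve through $\mathcal P_t$. 3. If $(\Gamma,\sigma,h)$ is such a curve, it is obtained by splitting $\Gamma_0$ with maximal splitting graph. Its double ends are exactly those over the ends of slope $2n$ of $\Gamma_0$. The two ends of each exchanged pair are adjacent to the same vertex, which is quadrivalent. $\Gamma$ has no flat vertex. -/

import Mathlib

open scoped BigOperators

namespace RealTropical

noncomputable section

/-! ### The lattice and the area form -/

/-- The lattice `N = ℤ²` of co-characters. -/
abbrev CoLat : Type := ℤ × ℤ

/-- The plane `N_ℝ = N ⊗ ℝ`. -/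
abbrev Plane : Type := ℝ × ℝ

/-- The inclusion `N ⊂ N_ℝ`. -/
def CoLat.toPlane (u : CoLat) : Plane := ((u.1 : ℝ), (u.2 : ℝ))

/-- The generator `ω` of `Λ² M`, on `N`. -/
def area (u v : CoLat) : ℤ := u.1 * v.2 - u.2 * v.1

/-- The extension of `ω` to `N_ℝ`. -/
def areaR (u v : Plane) : ℝ := u.1 * v.2 - u.2 * v.1

/-- Primitive lattice vectors. -/
def CoLat.IsPrimitive (u : CoLat) : Prop := IsCoprime u.1 u.2

/-! ### Rational parametrized tropical curves -/

/-- A rational abstract tropical curve with unbounded ends indexed by `E`: a finite metric tree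
without vertices of valence less than three.  `V` is the set of finite vertices, `graph` consists of
the bounded edges, `len` is the length function (relevant on adjacent pairs only), and `attach e` is
the vertex to which the unbounded end `e` is adjacent. -/
structure TropCurve (E : Type) where
  V : Type
  fintypeV : Fintype V
  graph : SimpleGraph V
  isTree : graph.IsTree
  len : V → V → ℝ
  len_symm : ∀ v w, len v w = len w v
  len_pos : ∀ v w, graph.Adj v w → 0 < len v w
  attach : E → V
  three_le_valence : ∀ v, 3 ≤ (graph.neighborSet v).ncard + {e : E | attach e = v}.ncard

attribute [instance] TropCurve.fintypeV

/-- The valence of a vertex. -/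
def TropCurve.valence {E : Type} (Γ : TropCurve E) (v : Γ.V) : ℕ :=
  (Γ.graph.neighborSet v).ncard + {e : E | Γ.attach e = v}.ncard

open scoped Classical in
/-- A rational parametrized tropical curve `h : Γ → N_ℝ`.  The map `h` is affine on edges, so it is
given by the images `pos v` of the vertices and by the slopes `endSlope e ∈ N` of the unbounded ends
(oriented towards infinity); `slope v w ∈ N` is the slope of a bounded edge `vw` oriented from `v`
to `w` (irrelevant for non-adjacent pairs). -/
structure ParamCurve (E : Type) [Fintype E] extends TropCurve E where
  pos : V → Plane
  slope : V → V → CoLat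
  endSlope : E → CoLat
  pos_sub : ∀ v w, graph.Adj v w → pos w - pos v = len v w • (slope v w).toPlane
  balancing : ∀ v, (∑ w ∈ Finset.univ.filter (fun w => graph.Adj v w), slope v w)
    + (∑ e ∈ Finset.univ.filter (fun e => attach e = v), endSlope e) = 0

namespace ParamCurve

variable {E : Type} [Fintype E] (Γ : ParamCurve E)

/-- The degree: the multiset of slopes of the unbounded ends. -/
def degree : Multiset CoLat := (Finset.univ : Finset E).val.map Γ.endSlope

/-- The image `h(Γ) ⊂ N_ℝ`. -/
def image : Set Plane :=
  {x | (∃ v w, Γ.graph.Adj v w ∧ x ∈ segment ℝ (Γ.pos v) (Γ.pos w)) ∨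
    ∃ e, ∃ a : ℝ, 0 ≤ a ∧ x = Γ.pos (Γ.attach e) + a • (Γ.endSlope e).toPlane}

/-- The moment `ω(n_e, p)`, `p ∈ h(e)`, of an unbounded end. -/
def moment (e : E) : ℝ := areaR (Γ.endSlope e).toPlane (Γ.pos (Γ.attach e))

/-- The slopes of the edges and ends at `v`, oriented away from `v`. -/
def outSlopes (v : Γ.V) : Set CoLat :=
  {u | (∃ w, Γ.graph.Adj v w ∧ u = Γ.slope v w) ∨ ∃ e, Γ.attach e = v ∧ u = Γ.endSlope e}

/-- A flat vertex: the slopes of all outgoing edges lie on a common line. -/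
def IsFlat (v : Γ.V) : Prop := ∀ a ∈ Γ.outSlopes v, ∀ b ∈ Γ.outSlopes v, area a b = 0

/-- The edges adjacent to a vertex: `Sum.inl` for bounded edges, `Sum.inr` for unbounded ends. -/
def edgesAt (v : Γ.V) : Set (Sym2 Γ.V ⊕ E) :=
  {x | (∃ w, Γ.graph.Adj v w ∧ x = Sum.inl s(v, w)) ∨ ∃ e, Γ.attach e = v ∧ x = Sum.inr e}

/-- Membership of an edge in `Γ_even`, the minimal subgraph that contains all unbounded ends of even
slope and, for each vertex all of whose adjacent edges but one are in the subgraph (an extendable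
vertex), also the remaining adjacent edge. -/
inductive InEven : Sym2 Γ.V ⊕ E → Prop
  | evenEnd (e : E) (u : CoLat) (h : Γ.endSlope e = 2 • u) : InEven (Sum.inr e)
  | extend (v : Γ.V) (x : Sym2 Γ.V ⊕ E) (hx : x ∈ Γ.edgesAt v)
      (h : ∀ y ∈ Γ.edgesAt v, y ≠ x → InEven y) : InEven x

/-- The subgraph `Γ_even`, as a set of edges and ends. -/
def evenGraph : Set (Sym2 Γ.V ⊕ E) := {x | Γ.InEven x}

end ParamCurve

/-! ### Real structures -/

/-- A real structure on a parametrized tropical curve: an involutive isometry `σ` with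
`h ∘ σ = h`. -/
structure RealStructure {E : Type} [Fintype E] (Γ : ParamCurve E) where
  onV : Equiv.Perm Γ.V
  onE : Equiv.Perm E
  involV : ∀ v, onV (onV v) = v
  involE : ∀ e, onE (onE e) = e
  adj_iff : ∀ v w, Γ.graph.Adj (onV v) (onV w) ↔ Γ.graph.Adj v w
  len_eq : ∀ v w, Γ.graph.Adj v w → Γ.len (onV v) (onV w) = Γ.len v w
  attach_eq : ∀ e, Γ.attach (onE e) = onV (Γ.attach e)
  pos_eq : ∀ v, Γ.pos (onV v) = Γ.pos v
  endSlope_eq : ∀ e, Γ.endSlope (onE e) = Γ.endSlope e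

/-- Isomorphisms of real parametrized tropical curves: isometries that commute with the maps to
`N_ℝ` and with the involutions.  They need not respect any labelling of the ends. -/
structure RealIso {E E' : Type} [Fintype E] [Fintype E'] (Γ : ParamCurve E) (σ : RealStructure Γ)
    (Γ' : ParamCurve E') (σ' : RealStructure Γ') where
  onV : Γ.V ≃ Γ'.V
  onE : E ≃ E'
  adj_iff : ∀ v w, Γ'.graph.Adj (onV v) (onV w) ↔ Γ.graph.Adj v w
  len_eq : ∀ v w, Γ.graph.Adj v w → Γ'.len (onV v) (onV w) = Γ.len v w
  attach_eq : ∀ e, Γ'.attach (onE e) = onV (Γ.attach e)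
  pos_eq : ∀ v, Γ'.pos (onV v) = Γ.pos v
  endSlope_eq : ∀ e, Γ'.endSlope (onE e) = Γ.endSlope e
  commV : ∀ v, onV (σ.onV v) = σ'.onV (onV v)
  commE : ∀ e, onE (σ.onE e) = σ'.onE (onE e)

open scoped Classical in
/-- The real curve `(Γ, σ, h)` is obtained from the parametrized curve `(Γ₀, h₀)` by doubling part
of `Γ₀`: there is a graph morphism `π : Γ → Γ₀` with `h = h₀ ∘ π` whose fibres are the orbits of `σ`,
lengths of doubled bounded edges are twice the original ones, and slopes of doubled ends are half
the original ones.  (The boundary points of the doubled part are vertices of `Γ₀`; this is always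
so when the closure of the doubled part is a subgraph, as for a maximal splitting.) -/
structure Splitting {E₀ E : Type} [Fintype E₀] [Fintype E] (Γ₀ : ParamCurve E₀)
    (Γ : ParamCurve E) (σ : RealStructure Γ) where
  projV : Γ.V → Γ₀.V
  projE : E → E₀
  surjV : Function.Surjective projV
  surjE : Function.Surjective projE
  adj : ∀ v w, Γ.graph.Adj v w → Γ₀.graph.Adj (projV v) (projV w)
  surjAdj : ∀ a b, Γ₀.graph.Adj a b → ∃ v w, projV v = a ∧ projV w = b ∧ Γ.graph.Adj v w
  attach_eq : ∀ e, projV (Γ.attach e) = Γ₀.attach (projE e)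
  pos_eq : ∀ v, Γ₀.pos (projV v) = Γ.pos v
  fibreV : ∀ v w, projV v = projV w ↔ w = v ∨ w = σ.onV v
  fibreE : ∀ e f, projE e = projE f ↔ f = e ∨ f = σ.onE e
  len_eq : ∀ v w, Γ.graph.Adj v w → Γ.len v w =
    (if σ.onV v = v ∧ σ.onV w = w then 1 else 2) * Γ₀.len (projV v) (projV w)
  endSlope_eq : ∀ e, Γ₀.endSlope (projE e) =
    (if σ.onE e = e then 1 else 2 : ℤ) • Γ.endSlope e

namespace Splitting

variable {E₀ E : Type} [Fintype E₀] [Fintype E] {Γ₀ : ParamCurve E₀} {Γ : ParamCurve E}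
  {σ : RealStructure Γ}

/-- The (closure of the) splitting graph: the edges and ends of `Γ₀` with two preimages in `Γ`, that
is, the images of those that `σ` does not fix. -/
def splitGraph (S : Splitting Γ₀ Γ σ) : Set (Sym2 Γ₀.V ⊕ E₀) :=
  {x | (∃ v w, Γ.graph.Adj v w ∧ ¬ (σ.onV v = v ∧ σ.onV w = w) ∧
      x = Sum.inl s(S.projV v, S.projV w)) ∨
    ∃ e, σ.onE e ≠ e ∧ x = Sum.inr (S.projE e)}

/-- The splitting graph is maximal: its closure is `Γ_even`. -/
def IsMaximal (S : Splitting Γ₀ Γ σ) : Prop := S.splitGraph = Γ₀.evenGraph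

end Splitting

/-! ### Real rational curves over the field of Laurent series -/

/-- The field `ℂ((t))`. -/
abbrev Ser : Type := LaurentSeries ℂ

/-- Complex conjugation on `ℂ((t))`, coefficient by coefficient; its fixed field is `ℝ((t))`. -/
def conjSer (x : Ser) : Ser := HahnSeries.map x (starRingEnd ℂ)

/-- A parametrized real rational curve
`f : y ↦ χ ∏ⱼ (y - αⱼ)^(νⱼ) ∈ Hom(M, ℂ((t))^*) = (ℂ((t))^*)²` with marked points `αⱼ`: the
co-character `χ` is real and the points `αⱼ` are real or come in conjugated pairs with the same
exponent vector. -/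
structure RealRationalCurve (E : Type) (ν : E → CoLat) where
  chi₁ : Ser
  chi₂ : Ser
  chi₁_ne : chi₁ ≠ 0
  chi₂_ne : chi₂ ≠ 0
  chi₁_real : conjSer chi₁ = chi₁
  chi₂_real : conjSer chi₂ = chi₂
  pt : E → Ser
  pt_injective : Function.Injective pt
  conjE : Equiv.Perm E
  pt_conj : ∀ e, pt (conjE e) = conjSer (pt e)
  exponent_conj : ∀ e, ν (conjE e) = ν e

/-- The moment of the curve at the marked point `αₑ`: the value there of the monomial
`ι_n ω = ω(n, ·) ∈ M`, `n = νₑ`, which is the coordinate of the image of `αₑ` on the toric divisor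
of the ray directed by `n`. -/
def RealRationalCurve.momentAt {E : Type} [Fintype E] {ν : E → CoLat} (f : RealRationalCurve E ν)
    (e : E) : Ser :=
  f.chi₁ ^ (-(ν e).2) * f.chi₂ ^ (ν e).1 * ∏ i, (f.pt e - f.pt i) ^ area (ν e) (ν i)

/-- A symmetric configuration `𝒫_t` on the toric boundary: for each `j` a pair of opposite real
points with coordinates `± re j ∈ ℝ((t))^*` on the divisor of the direction `n j`, and for each `k` a
pair of conjugated purely imaginary points with coordinates `± im k ∈ iℝ((t))^*` on the divisor of a
single direction `n₁`, subject to the Menelaus condition `∏ |re j| ∏ |im k|² = 1`. -/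
structure SymConfig (r s : ℕ) where
  re : Fin r → Ser
  im : Fin s → Ser
  re_ne : ∀ j, re j ≠ 0
  im_ne : ∀ k, im k ≠ 0
  re_real : ∀ j, conjSer (re j) = re j
  im_imag : ∀ k, conjSer (im k) = -im k
  menelaus : (∏ j, re j) * ∏ k, im k ^ 2 = 1 ∨ (∏ j, re j) * ∏ k, im k ^ 2 = -1

/-- The tropical moments of a symmetric configuration: the moment of a real point is computed with
the primitive vector `n j`, that of a pair of conjugated points with `2 n₁`. -/
def SymConfig.tropMoment {r s : ℕ} (P : SymConfig r s) : Fin r ⊕ Fin s → ℝ :=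
  Sum.elim (fun j => ((P.re j).order : ℝ)) (fun k => 2 * ((P.im k).order : ℝ))

/-- The curve passes through at least one point of each pair of the configuration. -/
def RealRationalCurve.PassesThrough {E : Type} [Fintype E] {ν : E → CoLat}
    (f : RealRationalCurve E ν) {r s : ℕ} (n : Fin r → CoLat) (n₁ : CoLat) (P : SymConfig r s) : Prop :=
  (∀ j, ∃ e, ν e = n j ∧ (f.momentAt e = P.re j ∨ f.momentAt e = -P.re j)) ∧
  (∀ k, ∃ e, ν e = n₁ ∧ (f.momentAt e = P.im k ∨ f.momentAt e = -P.im k))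

/-! ### Tropicalization

A model of `ℙ¹` over `ℂ[[t]]` with irreducible special fibre is given by a coordinate
`(y - c) / t^ρ` with `c ∈ ℂ((t))`, `ρ ∈ ℤ`; each component of the special fibre of the stable model
of a marked `ℙ¹` is obtained in this way. -/

open scoped Classical in
/-- The specialization of the point `a` to the component with coordinate `(y - c) / t^ρ`. -/
def specialize (c : Ser) (ρ : ℤ) (a : Ser) : OnePoint ℂ :=
  if ∀ k < ρ, (a - c).coeff k = 0 then ((a - c).coeff ρ : ℂ) else OnePoint.infty

open scoped Classical in
/-- The order of the function `y - a = t^ρ · ((y - c) / t^ρ) + (c - a)` along the component with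
coordinate `(y - c) / t^ρ`, namely `min (ρ, val (c - a))`. -/
def ordAlong (c : Ser) (ρ : ℤ) (a : Ser) : ℤ :=
  if c = a then ρ else min ρ (c - a).order

/-- The ends `i` and `j` lie in the same connected component of the complement of the vertex `w`. -/
def TropCurve.SameBranch {E : Type} (Γ : TropCurve E) (w : Γ.V) (i j : E) : Prop :=
  i = j ∨ ∃ p : Γ.graph.Walk (Γ.attach i) (Γ.attach j), w ∉ p.support

/-- The real parametrized tropical curve `(Γ, σ, h)` is the tropicalization of `f`.  The vertices of
`Γ` correspond to components of the special fibre of the stable model of the marked curve, with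
coordinates `(y - c w) / t^(ρ w)`:
* two marked points specialize to the same point of the component of `w` exactly when the
  corresponding ends of `Γ` are on the same side of `w`;
* the length of a bounded edge is the thickness `l` of the node `xy = t^l`, given by the two
  coordinates;
* `h(w)` is the order of `f` along the component of `w`;
* the involution `σ` is induced by complex conjugation.
The ends of `Γ` have slopes the exponents of `f`, by the type of `f`. -/
def RealRationalCurve.TropicalizesTo {E : Type} [Fintype E] (Γ : ParamCurve E)
    (f : RealRationalCurve E Γ.endSlope) (σ : RealStructure Γ) : Prop :=
  ∃ (c : Γ.V → Ser) (ρ : Γ.V → ℤ),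
    (∀ w i j, specialize (c w) (ρ w) (f.pt i) = specialize (c w) (ρ w) (f.pt j) ↔
      Γ.SameBranch w i j) ∧
    (∀ v w, Γ.graph.Adj v w →
      Γ.len v w = ((ρ v + ρ w - 2 * min (ρ w) (ordAlong (c v) (ρ v) (c w)) : ℤ) : ℝ)) ∧
    (∀ w, Γ.pos w = CoLat.toPlane ((f.chi₁.order, f.chi₂.order) +
      ∑ i, ordAlong (c w) (ρ w) (f.pt i) • Γ.endSlope i)) ∧
    (∀ w, ρ (σ.onV w) = ρ w ∧ ordAlong (c (σ.onV w)) (ρ w) (conjSer (c w)) = ρ w) ∧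
    (∀ e, σ.onE e = f.conjE e)

/-! ### The class of curves under consideration -/

/-- The labelled degree `Δ(s)`: the vectors `n j`, and `s` times the vector `2 n₁`. -/
def degreeS {r : ℕ} (s : ℕ) (n : Fin r → CoLat) (n₁ : CoLat) : Fin r ⊕ Fin s → CoLat :=
  Sum.elim n (fun _ => 2 • n₁)

/-- The degree `Δ`: the vectors `n j`, and `2s` times the vector `n₁`. -/
def degreeFull {r : ℕ} (s : ℕ) (n : Fin r → CoLat) (n₁ : CoLat) : Multiset CoLat :=
  (Finset.univ : Finset (Fin r)).val.map n + Multiset.replicate (2 * s) n₁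

/-- `(Γ, σ, h)` has degree `Δ`, image `C` and is the tropicalization of a parametrized real
rational curve over `ℂ((t))` that passes through the configuration. -/
def IsRealSolution {r s : ℕ} (n : Fin r → CoLat) (n₁ : CoLat) (P : SymConfig r s) (C : Set Plane)
    {E : Type} [Fintype E] (Γ : ParamCurve E) (σ : RealStructure Γ) : Prop :=
  Γ.degree = degreeFull s n n₁ ∧ Γ.image = C ∧
    ∃ f : RealRationalCurve E Γ.endSlope, f.PassesThrough n n₁ P ∧ f.TropicalizesTo Γ σ

end

end RealTropical

open RealTropical

/-! An oriented edge of a parametrized curve carries two balanced flows: its slope, and the value of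
the area form on this slope and a point of its image. By `flow_eq_sum` both are sums over the ends
beyond the edge, so these ends determine the line spanned by the edge. Coincidences between such
lines are linear relations between moments of ends, with bounded integral coefficients. Off finitely
many hyperplanes only multiples of the Menelaus relation survive (`IsGeneric`). Hence the branches
at a vertex of `Γ₀` are pairwise non-parallel and `Γ₀` is trivalent. Two branches at one vertex that
carry only ends of slope `2 • n₁` would be parallel; so the even graph never extends beyond the even
ends (`evenGraph_eq`).

For a real solution `Γ`, complex conjugation turns the moment at a marked point into its conjugate.
Generic valuations tell the conditions apart, and a count of ends shows that `Γ` has `r` ends fixed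
by the involution and `s` exchanged pairs with opposite moments (`exists_endDoubling`). Since the
images agree, each bounded edge of `Γ` lies on the line of an edge or end of `Γ₀`. By genericity
(`weight_eq_iff`, `cases_of_weight_eq_iff`) it either splits the ends as a bounded edge of `Γ₀`
does, or cuts off exactly one exchanged pair. The second case is the one excluded by arithmetic: the
moments at the two marked points would have equal leading coefficients, while they are opposite and
nonzero (`not_beyond_pair`).

A tree whose vertices have valence at least three is determined by the splittings of its ends
(`SameSplits.exists_equiv`), so `Γ` is `Γ₀` with its even ends doubled. Positions of vertices follow
from two transverse lines, lengths from positions. The involution preserves all splittings and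
therefore fixes every vertex (`automorphism_eq_id`). Uniqueness results from composing the
identifications of two solutions with `Γ₀`. -/

/-! ### Branches of a tree. -/

namespace SimpleGraph

variable {V : Type*} {G : SimpleGraph V}

/-- The vertices that can be reached from `w` without passing through `v`. -/
def branchSet (G : SimpleGraph V) (v w : V) : Set V := {x | ∃ p : G.Walk w x, v ∉ p.support}

theorem self_mem_branchSet {v w : V} (h : v ≠ w) : w ∈ G.branchSet v w :=
  ⟨Walk.nil, by simpa using h⟩

theorem notMem_branchSet_self (v w : V) : v ∉ G.branchSet v w := by
  rintro ⟨p, hp⟩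
  exact hp p.end_mem_support

theorem branchSet_map {f : G ≃g G} {v w x : V} (h : x ∈ G.branchSet v w) :
    f x ∈ G.branchSet (f v) (f w) := by
  obtain ⟨p, hp⟩ := h
  refine ⟨p.map f.toHom, ?_⟩
  rw [Walk.support_map]
  intro hmem
  obtain ⟨y, hy, hyv⟩ := List.mem_map.1 hmem
  have : y = v := f.injective hyv
  exact hp (this ▸ hy)

theorem exists_cons_isPath {v w x : V} (hvw : G.Adj v w) (h : x ∈ G.branchSet v w) :
    ∃ q : G.Walk w x, (Walk.cons hvw q).IsPath := by
  classical
  obtain ⟨p, hp⟩ := h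
  refine ⟨p.bypass, ?_⟩
  rw [Walk.cons_isPath_iff]
  exact ⟨p.bypass_isPath, fun hmem => hp (p.support_bypass_subset_support hmem)⟩

namespace IsTree

/-- The path from `v` to `x` is unique, hence so is its first step. -/
theorem branchSet_unique (hG : G.IsTree) {v w w' x : V} (hw : G.Adj v w) (hw' : G.Adj v w')
    (h : x ∈ G.branchSet v w) (h' : x ∈ G.branchSet v w') : w = w' := by
  obtain ⟨q, hq⟩ := exists_cons_isPath hw h
  obtain ⟨q', hq'⟩ := exists_cons_isPath hw' h'
  have h1 := (hG.isAcyclic.subsingleton_path v x).elim ⟨_, hq⟩ ⟨_, hq'⟩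
  have h2 : Walk.cons hw q = Walk.cons hw' q' := congrArg Subtype.val h1
  injection h2

theorem exists_mem_branchSet (hG : G.IsTree) {v x : V} (h : v ≠ x) :
    ∃ w, G.Adj v w ∧ x ∈ G.branchSet v w := by
  classical
  obtain ⟨p⟩ := hG.connected.preconnected v x
  have hp := p.bypass_isPath
  generalize p.bypass = q at hp
  cases q with
  | nil => exact absurd rfl h
  | cons hadj q =>
    rw [Walk.cons_isPath_iff] at hp
    exact ⟨_, hadj, q, hp.2⟩

theorem notMem_branchSet_symm (hG : G.IsTree) {v w x : V} (hvw : G.Adj v w)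
    (h : x ∈ G.branchSet v w) : x ∉ G.branchSet w v := by
  classical
  rintro ⟨p, hp⟩
  obtain ⟨q, hq⟩ := exists_cons_isPath hvw h
  have h1 := (hG.isAcyclic.subsingleton_path v x).elim ⟨_, hq⟩ ⟨_, p.bypass_isPath⟩
  have h2 : Walk.cons hvw q = p.bypass := congrArg Subtype.val h1
  apply hp
  apply p.support_bypass_subset_support
  rw [← h2]
  simp

theorem mem_branchSet_or (hG : G.IsTree) {v w : V} (hvw : G.Adj v w) (x : V) :
    x ∈ G.branchSet v w ∨ x ∈ G.branchSet w v := by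
  by_cases hx : v = x
  · subst hx
    exact Or.inr (self_mem_branchSet hvw.ne')
  obtain ⟨u, hu, hxu⟩ := hG.exists_mem_branchSet hx
  by_cases huw : u = w
  · subst huw; exact Or.inl hxu
  right
  obtain ⟨q, hq⟩ := exists_cons_isPath hu hxu
  by_contra hcon
  classical
  have hmem : w ∈ (Walk.cons hu q).support := by
    by_contra hw
    exact hcon ⟨_, hw⟩
  have hwq : w ∈ q.support := by
    rw [Walk.support_cons, List.mem_cons] at hmem
    exact hmem.resolve_left hvw.ne'
  rw [Walk.cons_isPath_iff] at hq
  have : w ∈ G.branchSet v u := ⟨q.takeUntil w hwq, fun hv =>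
    hq.2 (q.support_takeUntil_subset_support hwq hv)⟩
  exact huw (hG.branchSet_unique hu hvw this (self_mem_branchSet hvw.ne))

/-- Removing an edge cuts the tree into two sides; complements of branches are thus handled by
reversing the edge. -/
theorem mem_branchSet_iff (hG : G.IsTree) {v w : V} (hvw : G.Adj v w) (x : V) :
    x ∈ G.branchSet v w ↔ x ∉ G.branchSet w v :=
  ⟨hG.notMem_branchSet_symm hvw, fun h => (hG.mem_branchSet_or hvw x).resolve_right h⟩

theorem branchSet_subset (hG : G.IsTree) {v w u : V} (hvw : G.Adj v w) (hwu : G.Adj w u)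
    (huv : u ≠ v) : G.branchSet w u ⊆ G.branchSet v w := by
  intro x hx
  rw [hG.mem_branchSet_iff hvw]
  intro hx'
  exact huv (hG.branchSet_unique hwu hvw.symm hx hx')

/-- A branch that does not contain `w` is contained in a branch at `w`. -/
theorem exists_branchSet_superset (hG : G.IsTree) {x y w : V} (hxy : G.Adj x y)
    (hw : w ∉ G.branchSet x y) : ∃ u, G.Adj w u ∧ G.branchSet x y ⊆ G.branchSet w u := by
  classical
  have hwy : w ≠ y := by
    rintro rfl
    exact hw (self_mem_branchSet hxy.ne)
  obtain ⟨u, hu, p, hp⟩ := hG.exists_mem_branchSet hwy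
  refine ⟨u, hu, ?_⟩
  rintro z ⟨q, hq⟩
  refine ⟨p.append q, ?_⟩
  rw [Walk.mem_support_append_iff]
  rintro (h | h)
  · exact hp h
  · exact hw ⟨q.takeUntil w h, fun hx => hq (q.support_takeUntil_subset_support h hx)⟩

theorem eq_of_adj_of_mem_of_notMem (hG : G.IsTree) {x y v w : V} (hxy : G.Adj x y)
    (hvw : G.Adj v w) (hw : w ∈ G.branchSet x y) (hv : v ∉ G.branchSet x y) :
    v = x ∧ w = y := by
  have hvx : v = x := by
    by_contra hne
    obtain ⟨p, hp⟩ := hw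
    refine hv ⟨p.append (Walk.cons hvw.symm Walk.nil), ?_⟩
    rw [Walk.mem_support_append_iff]
    rintro (h | h)
    · exact hp h
    · simp only [Walk.support_cons, Walk.support_nil, List.mem_cons, List.not_mem_nil,
        or_false] at h
      rcases h with h | h
      · exact hp (h ▸ p.end_mem_support)
      · exact hne h.symm
  subst hvx
  exact ⟨rfl, hG.branchSet_unique hvw hxy (self_mem_branchSet hvw.ne) hw⟩

/-- Two distinct vertices are adjacent as soon as a single oriented edge separates them. -/
theorem adj_of_unique_separation (hG : G.IsTree) {v w : V} (hne : v ≠ w)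
    (h : ∀ x y x' y', G.Adj x y → G.Adj x' y' → w ∈ G.branchSet x y → v ∉ G.branchSet x y →
      w ∈ G.branchSet x' y' → v ∉ G.branchSet x' y' → G.branchSet x y = G.branchSet x' y') :
    G.Adj v w := by
  obtain ⟨u, hvu, hwu⟩ := hG.exists_mem_branchSet hne
  by_cases huw : u = w
  · exact huw ▸ hvu
  exfalso
  -- If the first step `u` of the path is not yet `w`, the next edge `u u'` separates as well, but
  -- its branch does not contain `u`.
  obtain ⟨u', huu', hwu'⟩ := hG.exists_mem_branchSet huw
  have hu'v : u' ≠ v := by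
    rintro rfl
    exact hG.notMem_branchSet_symm hvu hwu hwu'
  have hv : v ∉ G.branchSet u u' := fun hv =>
    hu'v (hG.branchSet_unique huu' hvu.symm hv (self_mem_branchSet hvu.ne'))
  have := h v u u u' hvu huu' hwu (notMem_branchSet_self v u) hwu' hv
  exact notMem_branchSet_self u u' (this ▸ self_mem_branchSet hvu.ne)

/-- A consistent orientation of the edges of a finite tree points towards a vertex. -/
theorem exists_of_consistent [Finite V] (hG : G.IsTree) (T : V → V → Prop)
    (htot : ∀ v w, G.Adj v w → (T v w ↔ ¬ T w v))
    (hcons : ∀ v w v' w', G.Adj v w → G.Adj v' w' → T v w → T v' w' →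
      (G.branchSet v w ∩ G.branchSet v' w').Nonempty) :
    ∃ x, ∀ v w, G.Adj v w → (T v w ↔ x ∈ G.branchSet v w) := by
  suffices h : ∃ x, ∀ v w, G.Adj v w → T v w → x ∈ G.branchSet v w by
    obtain ⟨x, hx⟩ := h
    refine ⟨x, fun v w hvw => ⟨hx v w hvw, fun hmem => ?_⟩⟩
    rw [htot v w hvw]
    exact fun hT => hG.notMem_branchSet_symm hvw hmem (hx w v hvw.symm hT)
  by_cases hex : ∃ p : V × V, G.Adj p.1 p.2 ∧ T p.1 p.2
  -- The head `b` of a selected edge with smallest branch is the vertex sought. A selected branch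
  -- that misses `b` lies in one branch at `b`; by consistency the edge leading there is selected
  -- and does not go back to `a`, so its branch is strictly smaller.
  · obtain ⟨⟨a, b⟩, ⟨hab, hT⟩, hmin⟩ := exists_minimalFor_of_wellFoundedLT
      (fun p : V × V => G.Adj p.1 p.2 ∧ T p.1 p.2) (fun p => (G.branchSet p.1 p.2).ncard) hex
    refine ⟨b, fun v w hvw hTvw => ?_⟩
    by_contra hb
    obtain ⟨u, hbu, hsub⟩ := hG.exists_branchSet_superset hvw hb
    have hua : u ≠ a := by
      rintro rfl
      obtain ⟨z, hz, hz'⟩ := hcons _ _ _ _ hab hvw hT hTvw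
      exact hG.notMem_branchSet_symm hab hz (hsub hz')
    have hTbu : T b u := by
      rw [htot b u hbu]
      intro hTub
      obtain ⟨z, hz, hz'⟩ := hcons _ _ _ _ hbu.symm hvw hTub hTvw
      exact hG.notMem_branchSet_symm hbu (hsub hz') hz
    have hlt : (G.branchSet b u).ncard < (G.branchSet a b).ncard := by
      apply Set.ncard_lt_ncard _ (Set.toFinite _)
      refine ⟨hG.branchSet_subset hab hbu hua, fun h => ?_⟩
      exact notMem_branchSet_self b u (h (self_mem_branchSet hab.ne))
    have := hmin (j := (b, u)) ⟨hbu, hTbu⟩ hlt.le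
    exact absurd this (not_le.2 hlt)
  · obtain ⟨x⟩ := hG.connected.nonempty
    exact ⟨x, fun v w hvw hT => absurd ⟨(v, w), hvw, hT⟩ hex⟩

end IsTree

end SimpleGraph

/-! ### Ends beyond an edge, and balanced flows. -/

namespace RealTropical

namespace TropCurve

variable {E : Type} [Fintype E] (Γ : TropCurve E)

open scoped Classical in
/-- The ends on the side of `w` of the edge `vw`. -/
noncomputable def beyond (v w : Γ.V) : Finset E :=
  Finset.univ.filter fun e => Γ.attach e ∈ Γ.graph.branchSet v w

variable {Γ}

theorem mem_beyond {v w : Γ.V} {e : E} :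
    e ∈ Γ.beyond v w ↔ Γ.attach e ∈ Γ.graph.branchSet v w := by
  simp [beyond]

theorem mem_beyond_symm {v w : Γ.V} (h : Γ.graph.Adj v w) {e : E} :
    e ∈ Γ.beyond w v ↔ e ∉ Γ.beyond v w := by
  rw [mem_beyond, mem_beyond, Γ.isTree.mem_branchSet_iff h.symm]

variable (Γ) in
/-- The edges and ends adjacent to a vertex. -/
abbrev Branch (v : Γ.V) : Type := {w // Γ.graph.Adj v w} ⊕ {e // Γ.attach e = v}

/-- The ends of the tree in a given direction at a vertex. -/
noncomputable def branchEnds {v : Γ.V} : Γ.Branch v → Finset E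
  | Sum.inl w => Γ.beyond v w
  | Sum.inr e => {e.1}

theorem valence_eq_card (v : Γ.V) : Γ.valence v = Nat.card (Γ.Branch v) := by
  have : Finite {w // Γ.graph.Adj v w} := Subtype.finite
  rw [Nat.card_sum]
  rfl

theorem exists_ne_branch {v : Γ.V} (b b' : Γ.Branch v) :
    ∃ b'' : Γ.Branch v, b'' ≠ b ∧ b'' ≠ b' := by
  classical
  have h3 : 3 ≤ Nat.card (Γ.Branch v) := Γ.valence_eq_card v ▸ Γ.three_le_valence v
  have : Finite {w // Γ.graph.Adj v w} := Subtype.finite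
  have := Fintype.ofFinite (Γ.Branch v)
  rw [Nat.card_eq_fintype_card] at h3
  have hcard : ({b, b'} : Finset (Γ.Branch v)).card < (Finset.univ : Finset (Γ.Branch v)).card :=
    lt_of_le_of_lt Finset.card_le_two h3
  obtain ⟨x, -, hx⟩ := Finset.exists_mem_notMem_of_card_lt_card hcard
  refine ⟨x, ?_, ?_⟩ <;> rintro rfl <;> simp at hx

theorem branchEnds_disjoint {v : Γ.V} {b b' : Γ.Branch v} (h : b ≠ b') :
    Disjoint (branchEnds b) (branchEnds b') := by
  rw [Finset.disjoint_left]
  intro e he he'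
  rcases b with ⟨w, hw⟩ | ⟨f, hf⟩ <;> rcases b' with ⟨w', hw'⟩ | ⟨f', hf'⟩ <;>
    simp only [branchEnds, mem_beyond, Finset.mem_singleton] at he he'
  · exact h (by simp [Γ.isTree.branchSet_unique hw hw' he he'])
  · subst he'; subst hf'
    exact SimpleGraph.notMem_branchSet_self _ _ he
  · subst he; subst hf
    exact SimpleGraph.notMem_branchSet_self _ _ he'
  · subst he; subst he'; exact h rfl

theorem branchEnds_subset_beyond {v w : Γ.V} (hvw : Γ.graph.Adj v w) {b : Γ.Branch w}
    (hb : b ≠ Sum.inl ⟨v, hvw.symm⟩) : branchEnds b ⊆ Γ.beyond v w := by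
  intro e he
  rw [mem_beyond]
  rcases b with ⟨u, hu⟩ | ⟨f, hf⟩ <;> simp only [branchEnds, mem_beyond, Finset.mem_singleton] at he
  · refine Γ.isTree.branchSet_subset hvw hu ?_ he
    rintro rfl
    exact hb rfl
  · subst he; subst hf
    exact SimpleGraph.self_mem_branchSet hvw.ne

/-- Since `w` has a branch other than the one back to `v`, one either meets an end or moves on to a
strictly smaller branch. -/
theorem beyond_nonempty {v w : Γ.V} (hvw : Γ.graph.Adj v w) : (Γ.beyond v w).Nonempty := by
  induction hn : (Γ.graph.branchSet v w).ncard using Nat.strong_induction_on generalizing v w with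
  | _ n ih =>
    obtain ⟨b, hb, -⟩ := Γ.exists_ne_branch (v := w) (Sum.inl ⟨v, hvw.symm⟩) (Sum.inl ⟨v, hvw.symm⟩)
    refine Finset.Nonempty.mono (branchEnds_subset_beyond hvw hb) ?_
    rcases b with ⟨u, hu⟩ | ⟨f, hf⟩
    · have huv : u ≠ v := by
        rintro rfl
        exact hb rfl
      refine ih _ ?_ hu rfl
      rw [← hn]
      apply Set.ncard_lt_ncard _ (Set.toFinite _)
      refine ⟨Γ.isTree.branchSet_subset hvw hu huv, fun h => ?_⟩
      exact SimpleGraph.notMem_branchSet_self w u (h (SimpleGraph.self_mem_branchSet hvw.ne))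
    · exact ⟨f, by simp [branchEnds]⟩

theorem branchEnds_nonempty {v : Γ.V} (b : Γ.Branch v) : (branchEnds b).Nonempty := by
  rcases b with ⟨u, hu⟩ | ⟨f, hf⟩
  · exact beyond_nonempty hu
  · exact ⟨f, by simp [branchEnds]⟩

theorem exists_notMem_branchEnds {v : Γ.V} (b b' : Γ.Branch v) :
    ∃ e, e ∉ branchEnds b ∧ e ∉ branchEnds b' := by
  obtain ⟨c, h, h'⟩ := exists_ne_branch b b'
  obtain ⟨e, he⟩ := branchEnds_nonempty c
  exact ⟨e, Finset.disjoint_left.1 (branchEnds_disjoint h) he,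
    Finset.disjoint_left.1 (branchEnds_disjoint h') he⟩

/-- Beyond an oriented edge there are two disjoint branches. -/
theorem exists_two_branches {v w : Γ.V} (hvw : Γ.graph.Adj v w) :
    ∃ b b' : Γ.Branch w, b ≠ b' ∧ branchEnds b ⊆ Γ.beyond v w ∧ branchEnds b' ⊆ Γ.beyond v w := by
  obtain ⟨b, hb, -⟩ := Γ.exists_ne_branch (v := w) (Sum.inl ⟨v, hvw.symm⟩) (Sum.inl ⟨v, hvw.symm⟩)
  obtain ⟨b', hb', hne⟩ := Γ.exists_ne_branch (v := w) (Sum.inl ⟨v, hvw.symm⟩) b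
  exact ⟨b, b', hne.symm, branchEnds_subset_beyond hvw hb, branchEnds_subset_beyond hvw hb'⟩

theorem beyond_nontrivial {v w : Γ.V} (hvw : Γ.graph.Adj v w) : (Γ.beyond v w).Nontrivial := by
  obtain ⟨b, b', hne, h, h'⟩ := exists_two_branches hvw
  obtain ⟨e, he⟩ := branchEnds_nonempty b
  obtain ⟨e', he'⟩ := branchEnds_nonempty b'
  refine ⟨e, h he, e', h' he', ?_⟩
  rintro rfl
  exact Finset.disjoint_left.1 (branchEnds_disjoint hne) he he'

theorem exists_branch_superset {v w x : Γ.V} (hvw : Γ.graph.Adj v w)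
    (hx : x ∈ Γ.graph.branchSet v w) : ∃ b : Γ.Branch x, Γ.beyond w v ⊆ branchEnds b := by
  obtain ⟨u, hu, hsub⟩ := Γ.isTree.exists_branchSet_superset hvw.symm
    (Γ.isTree.notMem_branchSet_symm hvw hx)
  refine ⟨Sum.inl ⟨u, hu⟩, fun e he => ?_⟩
  exact mem_beyond.2 (hsub (mem_beyond.1 he))

/-- Two branches with a common vertex have a common end. -/
theorem exists_mem_beyond_of_mem {v w v' w' x : Γ.V} (h : Γ.graph.Adj v w)
    (h' : Γ.graph.Adj v' w') (hx : x ∈ Γ.graph.branchSet v w)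
    (hx' : x ∈ Γ.graph.branchSet v' w') : ∃ e, e ∈ Γ.beyond v w ∧ e ∈ Γ.beyond v' w' := by
  -- The complement of each of the two branches is contained in a single branch at `x`; an end in a
  -- third branch at `x` lies in neither complement.
  obtain ⟨b, hb⟩ := exists_branch_superset h hx
  obtain ⟨b', hb'⟩ := exists_branch_superset h' hx'
  obtain ⟨e, he, he'⟩ := exists_notMem_branchEnds b b'
  refine ⟨e, ?_, ?_⟩
  · by_contra hcon
    exact he (hb ((mem_beyond_symm h).2 hcon))
  · by_contra hcon
    exact he' (hb' ((mem_beyond_symm h').2 hcon))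

/-- A vertex of the first branch outside the second would lie on the opposite side of the edge
`v'w'`, and the two sets would share an end. So the ends of a branch determine its vertices. -/
theorem branchSet_subset_of_beyond_subset {v w v' w' : Γ.V} (h : Γ.graph.Adj v w)
    (h' : Γ.graph.Adj v' w') (hsub : Γ.beyond v w ⊆ Γ.beyond v' w') :
    Γ.graph.branchSet v w ⊆ Γ.graph.branchSet v' w' := by
  intro x hx
  rw [Γ.isTree.mem_branchSet_iff h']
  intro hx'
  obtain ⟨e, he, he'⟩ := exists_mem_beyond_of_mem h h'.symm hx hx'
  exact (mem_beyond_symm h').1 he' (hsub he)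

theorem branchSet_eq_of_beyond_eq {v w v' w' : Γ.V} (h : Γ.graph.Adj v w)
    (h' : Γ.graph.Adj v' w') (heq : Γ.beyond v w = Γ.beyond v' w') :
    Γ.graph.branchSet v w = Γ.graph.branchSet v' w' :=
  (branchSet_subset_of_beyond_subset h h' heq.subset).antisymm
    (branchSet_subset_of_beyond_subset h' h heq.superset)

open scoped Classical in
/-- A balanced flow through an oriented edge is the total flow through the ends beyond it. -/
theorem flow_eq_sum {A : Type*} [AddCommGroup A] [IsAddTorsionFree A] (F : Γ.V → Γ.V → A)
    (g : E → A)
    (hF : ∀ v w, Γ.graph.Adj v w → F w v = -F v w)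
    (hbal : ∀ v, (∑ w ∈ Finset.univ.filter (fun w => Γ.graph.Adj v w), F v w)
      + (∑ e ∈ Finset.univ.filter (fun e => Γ.attach e = v), g e) = 0)
    {v w : Γ.V} (hvw : Γ.graph.Adj v w) : F v w = ∑ e ∈ Γ.beyond v w, g e := by
  set S : Finset Γ.V := Finset.univ.filter fun x => x ∈ Γ.graph.branchSet v w with hS
  have memS : ∀ x, x ∈ S ↔ x ∈ Γ.graph.branchSet v w := fun x => by simp [hS]
  -- Balancing is summed over the vertices beyond the edge: edges inside the branch cancel in pairs,
  -- and `w v` is the only bounded edge that leaves it.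
  have h0 : ∑ x ∈ S, ((∑ u ∈ Finset.univ.filter (fun u => Γ.graph.Adj x u), F x u)
      + (∑ e ∈ Finset.univ.filter (fun e => Γ.attach e = x), g e)) = 0 :=
    Finset.sum_eq_zero fun x _ => hbal x
  rw [Finset.sum_add_distrib] at h0
  have hends : ∑ x ∈ S, ∑ e ∈ Finset.univ.filter (fun e => Γ.attach e = x), g e
      = ∑ e ∈ Γ.beyond v w, g e := by
    rw [← Finset.sum_biUnion]
    · congr 1
      ext e
      simp [memS, mem_beyond]
    · intro a _ b _ hab
      rw [Function.onFun, Finset.disjoint_left]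
      intro e he he'
      simp only [Finset.mem_filter, Finset.mem_univ, true_and] at he he'
      exact hab (he.symm.trans he')
  have hedges : ∑ x ∈ S, ∑ u ∈ Finset.univ.filter (fun u => Γ.graph.Adj x u), F x u
      = F w v := by
    have hsplit : ∀ x ∈ S, ∑ u ∈ Finset.univ.filter (fun u => Γ.graph.Adj x u), F x u
        = (∑ u ∈ S, if Γ.graph.Adj x u then F x u else 0) + if x = w then F w v else 0 := by
      intro x hx
      rw [Finset.sum_filter, ← Finset.sum_add_sum_compl S]
      congr 1
      by_cases hxw : x = w
      · subst hxw
        rw [if_pos rfl, Finset.sum_eq_single v]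
        · rw [if_pos hvw.symm]
        · intro u hu huv
          rw [if_neg]
          intro hadj
          rw [Finset.mem_compl, memS] at hu
          exact huv (Γ.isTree.eq_of_adj_of_mem_of_notMem hvw hadj.symm ((memS _).1 hx) hu).1
        · intro hv
          rw [Finset.mem_compl, memS, not_not] at hv
          exact absurd hv (SimpleGraph.notMem_branchSet_self _ _)
      · rw [if_neg hxw]
        refine Finset.sum_eq_zero fun u hu => ?_
        rw [if_neg]
        intro hadj
        rw [Finset.mem_compl, memS] at hu
        exact hxw (Γ.isTree.eq_of_adj_of_mem_of_notMem hvw hadj.symm ((memS _).1 hx) hu).2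
    rw [Finset.sum_congr rfl hsplit, Finset.sum_add_distrib]
    have hanti : (∑ x ∈ S, ∑ u ∈ S, if Γ.graph.Adj x u then F x u else 0) = 0 := by
      -- By antisymmetry of the flow the double sum equals its own negative, so it vanishes in a
      -- torsion-free group.
      rw [← self_eq_neg]
      nth_rewrite 1 [Finset.sum_comm]
      rw [← Finset.sum_neg_distrib]
      refine Finset.sum_congr rfl fun x _ => ?_
      rw [← Finset.sum_neg_distrib]
      refine Finset.sum_congr rfl fun u _ => ?_
      by_cases h : Γ.graph.Adj x u
      · rw [if_pos h, if_pos h.symm, hF x u h]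
      · rw [if_neg h, if_neg (fun h' => h h'.symm), neg_zero]
    rw [hanti, zero_add, Finset.sum_ite_eq' S w, if_pos ((memS _).2
      (SimpleGraph.self_mem_branchSet hvw.ne))]
  rw [hends, hedges, hF v w hvw] at h0
  exact (neg_add_eq_zero.1 h0)

end TropCurve

/-! ### Reconstruction of a tree from the splittings of its ends. -/

namespace TropCurve

variable {E E₀ : Type} [Fintype E] [Fintype E₀] {Γ : TropCurve E} {Γ₀ : TropCurve E₀}
  {R : E → E₀ → Prop}

/-- The oriented edges `vw` and `xy` induce the same splitting of the ends. -/
def SameSplit (Γ : TropCurve E) (Γ₀ : TropCurve E₀) (R : E → E₀ → Prop) (v w : Γ.V)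
    (x y : Γ₀.V) : Prop :=
  ∀ e e₀, R e e₀ → (e ∈ Γ.beyond v w ↔ e₀ ∈ Γ₀.beyond x y)

/-- The bounded edges of two trees induce the same splittings of the ends, where the ends are
compared through the relation `R`. -/
structure SameSplits (Γ : TropCurve E) (Γ₀ : TropCurve E₀) (R : E → E₀ → Prop) : Prop where
  left_total : ∀ e, ∃ e₀, R e e₀
  right_total : ∀ e₀, ∃ e, R e e₀
  left : ∀ v w, Γ.graph.Adj v w → ∃ x y, Γ₀.graph.Adj x y ∧ SameSplit Γ Γ₀ R v w x y
  right : ∀ x y, Γ₀.graph.Adj x y → ∃ v w, Γ.graph.Adj v w ∧ SameSplit Γ Γ₀ R v w x y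

/-- The vertices `v` and `x` are on the same sides of corresponding edges. -/
def SamePosition (Γ : TropCurve E) (Γ₀ : TropCurve E₀) (R : E → E₀ → Prop) (v : Γ.V)
    (x : Γ₀.V) : Prop :=
  ∀ a b c d, Γ.graph.Adj a b → Γ₀.graph.Adj c d → SameSplit Γ Γ₀ R a b c d →
    (v ∈ Γ.graph.branchSet a b ↔ x ∈ Γ₀.graph.branchSet c d)

theorem SameSplit.swap {v w : Γ.V} {x y : Γ₀.V} (h : SameSplit Γ Γ₀ R v w x y) :
    SameSplit Γ₀ Γ (fun a b => R b a) x y v w :=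
  fun e e₀ he => (h e₀ e he).symm

theorem SameSplit.reverse {v w : Γ.V} {x y : Γ₀.V} (hvw : Γ.graph.Adj v w)
    (hxy : Γ₀.graph.Adj x y) (h : SameSplit Γ Γ₀ R v w x y) : SameSplit Γ Γ₀ R w v y x := by
  intro e e₀ he
  rw [mem_beyond_symm hvw, mem_beyond_symm hxy, h e e₀ he]

theorem SameSplits.swap (h : SameSplits Γ Γ₀ R) : SameSplits Γ₀ Γ (fun a b => R b a) where
  left_total := h.right_total
  right_total := h.left_total
  left x y hxy := by
    obtain ⟨v, w, hvw, hs⟩ := h.right x y hxy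
    exact ⟨v, w, hvw, hs.swap⟩
  right v w hvw := by
    obtain ⟨x, y, hxy, hs⟩ := h.left v w hvw
    exact ⟨x, y, hxy, hs.swap⟩

theorem SamePosition.swap {v : Γ.V} {x : Γ₀.V} (h : SamePosition Γ Γ₀ R v x) :
    SamePosition Γ₀ Γ (fun a b => R b a) x v :=
  fun a b c d hab hcd hs => (h c d a b hcd hab hs.swap).symm

theorem SameSplits.branchSet_eq (h : SameSplits Γ Γ₀ R) {v w v' w' : Γ.V} {x y : Γ₀.V}
    (hvw : Γ.graph.Adj v w) (hvw' : Γ.graph.Adj v' w') (hs : SameSplit Γ Γ₀ R v w x y)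
    (hs' : SameSplit Γ Γ₀ R v' w' x y) : Γ.graph.branchSet v w = Γ.graph.branchSet v' w' := by
  apply branchSet_eq_of_beyond_eq hvw hvw'
  ext e
  obtain ⟨e₀, he⟩ := h.left_total e
  rw [hs e e₀ he, hs' e e₀ he]

/-- Orient each edge of `Γ₀` towards the side that corresponds to the side of `v`. Two branches
containing `v` share an end, so this orientation is consistent and points to a vertex. -/
theorem SameSplits.exists_samePosition (h : SameSplits Γ Γ₀ R) (v : Γ.V) :
    ∃ x, SamePosition Γ Γ₀ R v x := by
  obtain ⟨z, hz⟩ := Γ₀.isTree.exists_of_consistent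
    (fun x y => ∃ a b, Γ.graph.Adj a b ∧ SameSplit Γ Γ₀ R a b x y ∧ v ∈ Γ.graph.branchSet a b)
    (by
      intro x y hxy
      constructor
      · rintro ⟨a, b, hab, hs, hv⟩ ⟨a', b', hab', hs', hv'⟩
        rw [h.branchSet_eq hab' hab.symm hs' (hs.reverse hab hxy)] at hv'
        exact Γ.isTree.notMem_branchSet_symm hab hv hv'
      · intro hn
        obtain ⟨a, b, hab, hs⟩ := h.right x y hxy
        refine ⟨a, b, hab, hs, ?_⟩
        rw [Γ.isTree.mem_branchSet_iff hab]
        exact fun hv => hn ⟨b, a, hab.symm, hs.reverse hab hxy, hv⟩)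
    (by
      rintro x y x' y' hxy hxy' ⟨a, b, hab, hs, hv⟩ ⟨a', b', hab', hs', hv'⟩
      obtain ⟨e, he, he'⟩ := exists_mem_beyond_of_mem hab hab' hv hv'
      obtain ⟨e₀, hee⟩ := h.left_total e
      exact ⟨Γ₀.attach e₀, mem_beyond.1 ((hs e e₀ hee).1 he),
        mem_beyond.1 ((hs' e e₀ hee).1 he')⟩)
  refine ⟨z, fun a b c d hab hcd hs => ?_⟩
  rw [← hz c d hcd]
  constructor
  · exact fun hv => ⟨a, b, hab, hs, hv⟩
  · rintro ⟨a', b', hab', hs', hv⟩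
    rwa [h.branchSet_eq hab hab' hs hs']

theorem SameSplits.samePosition_unique (h : SameSplits Γ Γ₀ R) {v : Γ.V} {x x' : Γ₀.V}
    (hx : SamePosition Γ Γ₀ R v x) (hx' : SamePosition Γ Γ₀ R v x') : x = x' := by
  by_contra hne
  obtain ⟨y, hxy, hmem⟩ := Γ₀.isTree.exists_mem_branchSet hne
  obtain ⟨a, b, hab, hs⟩ := h.right x y hxy
  have := (hx a b x y hab hxy hs).1 ((hx' a b x y hab hxy hs).2 hmem)
  exact SimpleGraph.notMem_branchSet_self _ _ this

/-- An edge of `Γ₀` separating `x` from `y` corresponds to an edge of `Γ` separating `v` from `w`,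
which can only be `vw`. -/
theorem SamePosition.adj (h : SameSplits Γ Γ₀ R) {v w : Γ.V} {x y : Γ₀.V}
    (hv : SamePosition Γ Γ₀ R v x) (hw : SamePosition Γ Γ₀ R w y) (hvw : Γ.graph.Adj v w) :
    Γ₀.graph.Adj x y := by
  refine Γ₀.isTree.adj_of_unique_separation ?_ ?_
  · rintro rfl
    exact hvw.ne (h.swap.samePosition_unique hv.swap hw.swap)
  · have key : ∀ c d, Γ₀.graph.Adj c d → y ∈ Γ₀.graph.branchSet c d →
        x ∉ Γ₀.graph.branchSet c d → SameSplit Γ Γ₀ R v w c d := by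
      intro c d hcd hy hx
      obtain ⟨a, b, hab, hs⟩ := h.right c d hcd
      rw [← hw a b c d hab hcd hs] at hy
      rw [← hv a b c d hab hcd hs] at hx
      obtain ⟨rfl, rfl⟩ := Γ.isTree.eq_of_adj_of_mem_of_notMem hab hvw hy hx
      exact hs
    intro c d c' d' hcd hcd' hy hx hy' hx'
    exact h.swap.branchSet_eq hcd hcd' (key c d hcd hy hx).swap (key c' d' hcd' hy' hx').swap

theorem SamePosition.sameSplit (h : SameSplits Γ Γ₀ R) {v w : Γ.V} {x y : Γ₀.V}
    (hv : SamePosition Γ Γ₀ R v x) (hw : SamePosition Γ Γ₀ R w y) (hvw : Γ.graph.Adj v w) :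
    SameSplit Γ Γ₀ R v w x y := by
  obtain ⟨c, d, hcd, hs⟩ := h.left v w hvw
  have hy := (hw v w c d hvw hcd hs).1 (SimpleGraph.self_mem_branchSet hvw.ne)
  have hx := mt (hv v w c d hvw hcd hs).2 (SimpleGraph.notMem_branchSet_self v w)
  obtain ⟨rfl, rfl⟩ := Γ₀.isTree.eq_of_adj_of_mem_of_notMem hcd (hv.adj h hw hvw) hy hx
  exact hs

/-- A tree is determined by the splittings of its ends given by its bounded edges. -/
theorem SameSplits.exists_equiv (h : SameSplits Γ Γ₀ R) : ∃ φ : Γ.V ≃ Γ₀.V,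
    (∀ v w, Γ₀.graph.Adj (φ v) (φ w) ↔ Γ.graph.Adj v w) ∧
    (∀ e e₀, R e e₀ → Γ₀.attach e₀ = φ (Γ.attach e)) ∧
    (∀ v w, Γ.graph.Adj v w → SameSplit Γ Γ₀ R v w (φ v) (φ w)) := by
  choose f hf using h.exists_samePosition
  have hbij : Function.Bijective f := by
    constructor
    · intro v v' hvv
      exact h.swap.samePosition_unique (hf v).swap (hvv ▸ (hf v').swap)
    · intro x
      obtain ⟨v, hv⟩ := h.swap.exists_samePosition x
      exact ⟨v, h.samePosition_unique (hf v) hv.swap⟩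
  refine ⟨Equiv.ofBijective f hbij, fun v w => ⟨fun hadj => ?_, fun hadj => ?_⟩, ?_, ?_⟩
  · exact (hf v).swap.adj h.swap (hf w).swap hadj
  · exact (hf v).adj h (hf w) hadj
  · intro e e₀ he
    refine h.samePosition_unique (v := Γ.attach e) ?_ (hf _)
    intro a b c d _ _ hs
    rw [← mem_beyond, ← mem_beyond, hs e e₀ he]
  · exact fun v w hvw => (hf v).sameSplit h (hf w) hvw

/-- An automorphism that preserves the splittings of the ends fixes all vertices. -/
theorem automorphism_eq_id (f : Γ.graph ≃g Γ.graph) (g : E → E)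
    (hfg : ∀ e, Γ.attach (g e) = f (Γ.attach e))
    (hg : ∀ v w, Γ.graph.Adj v w → ∀ e, g e ∈ Γ.beyond v w ↔ e ∈ Γ.beyond v w) (v : Γ.V) :
    f v = v := by
  by_contra hne
  obtain ⟨u, hvu, hmem⟩ := Γ.isTree.exists_mem_branchSet (Ne.symm hne)
  have hadj : Γ.graph.Adj (f v) (f u) := f.map_rel_iff.2 hvu
  have hsub : ∀ a b, Γ.graph.Adj a b → ∀ e, e ∈ Γ.beyond a b → g e ∈ Γ.beyond (f a) (f b) := by
    intro a b _ e he
    rw [mem_beyond, hfg]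
    exact SimpleGraph.branchSet_map (mem_beyond.1 he)
  -- The edge `vu` is the first step towards `f v`. Its image edge has at least the same ends beyond
  -- it, so its branch would contain its own starting vertex `f v`.
  have heq : Γ.beyond v u ⊆ Γ.beyond (f v) (f u) := by
    intro e he
    by_contra hcon
    rw [← hg _ _ hadj] at hcon
    exact hcon (hsub v u hvu e he)
  exact SimpleGraph.notMem_branchSet_self _ _ (branchSet_subset_of_beyond_subset hvu hadj heq hmem)

end TropCurve

/-! ### Slopes, moments and the lines spanned by edges. -/

noncomputable section

/-- The pairing of lattice vectors with a point of the plane given by the area form. -/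
def areaHom (p : Plane) : CoLat →+ ℝ :=
  AddMonoidHom.mk' (fun u => areaR u.toPlane p) (fun u v => by
    simp only [areaR, CoLat.toPlane, Prod.fst_add, Prod.snd_add]
    push_cast
    ring)

theorem areaHom_apply (p : Plane) (u : CoLat) :
    areaHom p u = (u.1 : ℝ) * p.2 - (u.2 : ℝ) * p.1 := rfl

theorem toPlane_injective : Function.Injective CoLat.toPlane := by
  intro u v h
  simp only [CoLat.toPlane, Prod.mk.injEq, Int.cast_inj] at h
  exact Prod.ext h.1 h.2

namespace ParamCurve

variable {E : Type} [Fintype E] {Γ : ParamCurve E}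

theorem slope_symm {v w : Γ.V} (h : Γ.graph.Adj v w) : Γ.slope w v = -Γ.slope v w := by
  have h1 := Γ.pos_sub v w h
  have h2 := Γ.pos_sub w v h.symm
  have hpos := Γ.len_pos v w h
  rw [Γ.len_symm w v] at h2
  have h3 : Γ.len v w • ((Γ.slope w v).toPlane + (Γ.slope v w).toPlane) = 0 := by
    rw [smul_add, ← h1, ← h2]
    abel
  have h4 := (smul_eq_zero.1 h3).resolve_left hpos.ne'
  simp only [CoLat.toPlane, Prod.mk_add_mk, Prod.mk_eq_zero] at h4
  obtain ⟨h5, h6⟩ := h4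
  norm_cast at h5 h6
  ext
  · simp only [Prod.fst_neg]; omega
  · simp only [Prod.snd_neg]; omega

/-- The slope of an edge or end, oriented away from the vertex. -/
def branchSlope {v : Γ.V} : Γ.Branch v → CoLat
  | Sum.inl w => Γ.slope v w
  | Sum.inr e => Γ.endSlope e

theorem slope_eq_sum {v w : Γ.V} (h : Γ.graph.Adj v w) :
    Γ.slope v w = ∑ e ∈ Γ.beyond v w, Γ.endSlope e :=
  TropCurve.flow_eq_sum Γ.slope Γ.endSlope (fun _ _ h => slope_symm h) Γ.balancing h

/-- The moment of an edge does not depend on the chosen point of its line, so it is antisymmetric in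
the orientation; applying the area form to the balancing condition shows that it is a balanced flow.
-/
theorem areaHom_slope_eq_sum {v w : Γ.V} (h : Γ.graph.Adj v w) :
    areaHom (Γ.pos v) (Γ.slope v w) = ∑ e ∈ Γ.beyond v w, Γ.moment e := by
  classical
  refine TropCurve.flow_eq_sum (fun v w => areaHom (Γ.pos v) (Γ.slope v w)) Γ.moment
    (fun v w h => ?_) (fun v => ?_) h
  · have h1 := Γ.pos_sub v w h
    have h2 : Γ.pos w = Γ.pos v + Γ.len v w • (Γ.slope v w).toPlane := by
      rw [← h1]; abel
    rw [slope_symm h, map_neg, h2, areaHom_apply, areaHom_apply]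
    simp only [CoLat.toPlane, Prod.fst_add, Prod.snd_add, Prod.smul_fst, Prod.smul_snd,
      smul_eq_mul]
    ring
  · have hb := congrArg (areaHom (Γ.pos v)) (Γ.balancing v)
    rw [map_add, map_sum, map_sum, map_zero] at hb
    convert hb using 2
    refine Finset.sum_congr (by congr) fun e he => ?_
    rw [Finset.mem_filter] at he
    rw [moment, he.2]
    rfl

theorem branchSlope_eq_sum {v : Γ.V} (b : Γ.Branch v) :
    branchSlope b = ∑ e ∈ TropCurve.branchEnds b, Γ.endSlope e := by
  rcases b with ⟨w, h⟩ | ⟨e, h⟩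
  · exact slope_eq_sum h
  · simp [branchSlope, TropCurve.branchEnds]

theorem areaHom_branchSlope {v : Γ.V} (b : Γ.Branch v) :
    areaHom (Γ.pos v) (branchSlope b) = ∑ e ∈ TropCurve.branchEnds b, Γ.moment e := by
  rcases b with ⟨w, h⟩ | ⟨e, h⟩
  · exact areaHom_slope_eq_sum h
  · subst h
    simp [branchSlope, TropCurve.branchEnds, moment, areaHom]

theorem branchSlope_mem_outSlopes {v : Γ.V} (b : Γ.Branch v) : branchSlope b ∈ Γ.outSlopes v := by
  rcases b with ⟨w, h⟩ | ⟨e, h⟩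
  · exact Or.inl ⟨w, h, rfl⟩
  · exact Or.inr ⟨e, h, rfl⟩

theorem areaHom_add_smul (p : Plane) (t : ℝ) (u : CoLat) :
    areaHom (p + t • u.toPlane) u = areaHom p u := by
  simp only [areaHom_apply, CoLat.toPlane, Prod.fst_add, Prod.snd_add, Prod.smul_fst,
    Prod.smul_snd, smul_eq_mul]
  ring

theorem areaHom_segment {v w : Γ.V} (h : Γ.graph.Adj v w) {x : Plane}
    (hx : x ∈ segment ℝ (Γ.pos v) (Γ.pos w)) :
    areaHom x (Γ.slope v w) = areaHom (Γ.pos v) (Γ.slope v w) := by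
  rw [segment_eq_image'] at hx
  obtain ⟨t, -, rfl⟩ := hx
  simp only [Γ.pos_sub v w h, smul_smul]
  exact areaHom_add_smul _ _ _

/-- The image of a parametrized curve lies on the lines spanned by its edges and ends. -/
theorem exists_branch_of_mem_image {x : Plane} (hx : x ∈ Γ.image) :
    ∃ (v : Γ.V) (b : Γ.Branch v),
      areaHom x (branchSlope b) = ∑ e ∈ TropCurve.branchEnds b, Γ.moment e := by
  rcases hx with ⟨v, w, h, hx⟩ | ⟨e, a, -, rfl⟩
  · refine ⟨v, Sum.inl ⟨w, h⟩, ?_⟩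
    rw [← areaHom_branchSlope]
    exact areaHom_segment h hx
  · refine ⟨Γ.attach e, Sum.inr ⟨e, rfl⟩, ?_⟩
    rw [← areaHom_branchSlope]
    exact areaHom_add_smul _ _ _

theorem pos_ne {v w : Γ.V} (h : Γ.graph.Adj v w) (hs : Γ.slope v w ≠ 0) : Γ.pos v ≠ Γ.pos w := by
  intro heq
  have h1 := Γ.pos_sub v w h
  rw [heq, sub_self] at h1
  have h2 := (smul_eq_zero.1 h1.symm).resolve_left (Γ.len_pos v w h).ne'
  exact hs (toPlane_injective (h2.trans (by simp [CoLat.toPlane, Prod.zero_eq_mk])))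

/-- If the image of an edge of a curve is contained in the image of another curve, then some edge
or end of the latter spans the same line. -/
theorem exists_branch_of_image_subset {E' : Type} [Fintype E'] {Γ' : ParamCurve E'}
    (himage : Γ.image ⊆ Γ'.image) {v w : Γ.V} (h : Γ.graph.Adj v w) (hs : Γ.slope v w ≠ 0) :
    ∃ (x : Γ'.V) (b : Γ'.Branch x),
      (area (Γ.slope v w) (branchSlope b) = 0) ∧
      ((branchSlope b).1 : ℝ) * ∑ e ∈ Γ.beyond v w, Γ.moment e =
        ((Γ.slope v w).1 : ℝ) * ∑ e ∈ TropCurve.branchEnds b, Γ'.moment e ∧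
      ((branchSlope b).2 : ℝ) * ∑ e ∈ Γ.beyond v w, Γ.moment e =
        ((Γ.slope v w).2 : ℝ) * ∑ e ∈ TropCurve.branchEnds b, Γ'.moment e := by
  have hinf : (segment ℝ (Γ.pos v) (Γ.pos w)).Infinite := by
    rw [segment_eq_image']
    refine (Set.Icc_infinite zero_lt_one).image ?_
    intro a _ b _ hab
    simp only [add_right_inj] at hab
    exact smul_left_injective ℝ (sub_ne_zero.2 (pos_ne h hs).symm) hab
  have hline : ∀ p : segment ℝ (Γ.pos v) (Γ.pos w), ∃ b : Σ x : Γ'.V, Γ'.Branch x,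
      areaHom p.1 (branchSlope b.2) = ∑ e ∈ TropCurve.branchEnds b.2, Γ'.moment e := by
    intro p
    obtain ⟨x, b, hb⟩ := exists_branch_of_mem_image
      (himage (Or.inl ⟨v, w, h, p.2⟩ : p.1 ∈ Γ.image))
    exact ⟨⟨x, b⟩, hb⟩
  choose f hf using hline
  have : ∀ x : Γ'.V, Finite {w // Γ'.graph.Adj x w} := fun _ => Subtype.finite
  have := hinf.to_subtype
  -- A nondegenerate segment has infinitely many points and the other curve spans finitely many
  -- lines, so two distinct points of the segment lie on the same one.
  obtain ⟨p, q, hpq, hfpq⟩ := Finite.exists_ne_map_eq_of_infinite f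
  refine ⟨(f p).1, (f p).2, ?_⟩
  have h1 := hf p
  have h2 := hf q
  rw [← hfpq] at h2
  have h3 := areaHom_segment h p.2
  have h4 := areaHom_segment h q.2
  rw [areaHom_slope_eq_sum h] at h3 h4
  have hne : p.1 ≠ q.1 := fun h => hpq (Subtype.ext h)
  generalize (f p).2 = b at h1 h2
  generalize branchSlope b = u at *
  generalize Γ.slope v w = a at *
  generalize (∑ e ∈ TropCurve.branchEnds b, Γ'.moment e) = mB at *
  generalize (∑ e ∈ Γ.beyond v w, Γ.moment e) = mA at *
  obtain ⟨⟨p₁, p₂⟩, hp⟩ := p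
  obtain ⟨⟨q₁, q₂⟩, hq⟩ := q
  simp only [areaHom_apply] at h1 h2 h3 h4
  have harea : (a.1 : ℝ) * u.2 - a.2 * u.1 = 0 := by
    by_contra hD
    apply hne
    have e1 : (a.1 : ℝ) * (p₂ - q₂) = a.2 * (p₁ - q₁) := by linarith
    have e2 : (u.1 : ℝ) * (p₂ - q₂) = u.2 * (p₁ - q₁) := by linarith
    have k1 : ((a.1 : ℝ) * u.2 - a.2 * u.1) * (p₁ - q₁) = 0 := by
      linear_combination (-(a.1 : ℝ)) * e2 + (u.1 : ℝ) * e1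
    have k2 : ((a.1 : ℝ) * u.2 - a.2 * u.1) * (p₂ - q₂) = 0 := by
      linear_combination (-(a.2 : ℝ)) * e2 + (u.2 : ℝ) * e1
    have k3 := (mul_eq_zero.1 k1).resolve_left hD
    have k4 := (mul_eq_zero.1 k2).resolve_left hD
    exact Prod.ext (by simpa using sub_eq_zero.1 k3) (by simpa using sub_eq_zero.1 k4)
  refine ⟨?_, ?_, ?_⟩
  · rw [area]; exact_mod_cast harea
  · linear_combination (-(u.1 : ℝ)) * h3 + (a.1 : ℝ) * h1 + p₁ * harea
  · linear_combination (-(u.2 : ℝ)) * h3 + (a.2 : ℝ) * h1 + p₂ * harea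

end ParamCurve

end

/-! ### Genericity of the moments. -/

noncomputable section

/-- The total size of the coordinates of a family of lattice vectors. -/
def totalSize {I : Type} [Fintype I] (d : I → CoLat) : ℤ := ∑ i, (|(d i).1| + |(d i).2|)

/-- There are no linear relations with bounded integral coefficients between the moments other
than the multiples of the Menelaus relation. -/
def IsGeneric {I : Type} [Fintype I] (d : I → CoLat) (μ : I → ℝ) : Prop :=
  -- The bound covers all relations used below. The largest coefficients come from concurrent lines:
  -- three areas, each at most twice the square of `totalSize d`.
  ∀ c : I → ℤ, (∀ i, |c i| ≤ 8 * (totalSize d + 1) ^ 2) → ∑ i, (c i : ℝ) * μ i = 0 →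
    ∀ i j, c i = c j

/-- One linear form is taken for each non-constant integral vector `c` in the box. If `c i ≠ c j`,
it does not vanish at the difference of the basis vectors `i` and `j`, whose coordinates sum to
zero. -/
theorem exists_hyperplanes_isGeneric {I : Type} [Fintype I] (d : I → CoLat) :
    ∃ H : Finset ((I → ℝ) →ₗ[ℝ] ℝ), (∀ φ ∈ H, ∃ μ : I → ℝ, ∑ i, μ i = 0 ∧ φ μ ≠ 0) ∧
      ∀ μ : I → ℝ, (∀ φ ∈ H, φ μ ≠ 0) → IsGeneric d μ := by
  classical
  set N := 8 * (totalSize d + 1) ^ 2 with hN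
  let F : (I → ℤ) → ((I → ℝ) →ₗ[ℝ] ℝ) := fun c => ∑ i, (c i : ℝ) • LinearMap.proj i
  have hF : ∀ c μ, F c μ = ∑ i, (c i : ℝ) * μ i := by
    intro c μ
    simp [F, LinearMap.sum_apply]
  refine ⟨((Fintype.piFinset fun _ : I => Finset.Icc (-N) N).filter
    (fun c => ∃ i j, c i ≠ c j)).image F, ?_, ?_⟩
  · intro φ hφ
    obtain ⟨c, hc, rfl⟩ := Finset.mem_image.1 hφ
    obtain ⟨-, i, j, hij⟩ := Finset.mem_filter.1 hc
    refine ⟨Pi.single i 1 - Pi.single j 1, ?_, ?_⟩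
    · simp [Finset.sum_sub_distrib]
    · rw [hF]
      simp only [Pi.sub_apply, mul_sub, Finset.sum_sub_distrib, Pi.single_apply, mul_ite, mul_one,
        mul_zero, Finset.sum_ite_eq', Finset.mem_univ, if_true]
      rw [sub_ne_zero]
      exact_mod_cast hij
  · intro μ hμ c hc hsum
    by_contra hcon
    push Not at hcon
    refine hμ (F c) (Finset.mem_image_of_mem _ (Finset.mem_filter.2 ⟨?_, hcon⟩)) ?_
    · simpa [Fintype.mem_piFinset, abs_le] using hc
    · rw [hF, hsum]

section Bounds

variable {I : Type} [Fintype I] (d : I → CoLat)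

theorem totalSize_nonneg : 0 ≤ totalSize d := Finset.sum_nonneg fun _ _ => by positivity

theorem abs_weighted_sum_le (W : I → ℤ) (N : ℤ) (hW : ∀ i, |W i| ≤ N) :
    |(∑ i, W i • d i).1| ≤ N * totalSize d ∧ |(∑ i, W i • d i).2| ≤ N * totalSize d := by
  rw [Prod.fst_sum, Prod.snd_sum, totalSize, Finset.mul_sum]
  constructor
  · refine (Finset.abs_sum_le_sum_abs _ _).trans (Finset.sum_le_sum fun i _ => ?_)
    simp only [Prod.smul_fst, smul_eq_mul, abs_mul]
    nlinarith [hW i, abs_nonneg (W i), abs_nonneg (d i).1, abs_nonneg (d i).2]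
  · refine (Finset.abs_sum_le_sum_abs _ _).trans (Finset.sum_le_sum fun i _ => ?_)
    simp only [Prod.smul_snd, smul_eq_mul, abs_mul]
    nlinarith [hW i, abs_nonneg (W i), abs_nonneg (d i).1, abs_nonneg (d i).2]

theorem abs_sum_le (A : Finset I) :
    |(∑ i ∈ A, d i).1| ≤ totalSize d ∧ |(∑ i ∈ A, d i).2| ≤ totalSize d := by
  classical
  have := abs_weighted_sum_le d (fun i => if i ∈ A then 1 else 0) 1
    (fun i => by split_ifs <;> simp)
  simpa [ite_smul] using this

end Bounds

/-! ### Curves with generic moments, and the even graph. -/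

namespace ParamCurve

variable {I : Type} [Fintype I] {Γ : ParamCurve I}

theorem abs_branchSlope_le {v : Γ.V} (b : Γ.Branch v) :
    |(branchSlope b).1| ≤ totalSize Γ.endSlope ∧ |(branchSlope b).2| ≤ totalSize Γ.endSlope := by
  rw [branchSlope_eq_sum]
  exact abs_sum_le _ _

theorem sum_indicator_mul [DecidableEq I] (μ : I → ℝ) (A : Finset I) (k : ℤ) :
    ∑ i, ((if i ∈ A then k else 0 : ℤ) : ℝ) * μ i = k * ∑ i ∈ A, μ i := by
  rw [Finset.mul_sum]
  simp [ite_mul]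

/-- The three lines meet at the image of `v`, and any three vectors of the plane satisfy this linear
relation with their areas as coefficients. -/
theorem area_branchSlope_relation {v : Γ.V} (b b' b'' : Γ.Branch v) :
    (area (branchSlope b') (branchSlope b'') : ℝ) * ∑ e ∈ TropCurve.branchEnds b, Γ.moment e +
      (area (branchSlope b'') (branchSlope b) : ℝ) * ∑ e ∈ TropCurve.branchEnds b', Γ.moment e +
      (area (branchSlope b) (branchSlope b') : ℝ) * ∑ e ∈ TropCurve.branchEnds b'', Γ.moment e
      = 0 := by
  simp only [← areaHom_branchSlope, areaHom_apply, area]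
  push_cast
  ring

theorem branchSlope_ne_zero (hgen : IsGeneric Γ.endSlope Γ.moment) {v : Γ.V} (b : Γ.Branch v) :
    branchSlope b ≠ 0 := by
  classical
  intro h0
  have h1 := areaHom_branchSlope b
  rw [h0, map_zero] at h1
  obtain ⟨e, he⟩ := TropCurve.branchEnds_nonempty b
  obtain ⟨f, hf, -⟩ := TropCurve.exists_notMem_branchEnds b b
  have := hgen (fun i => if i ∈ TropCurve.branchEnds b then 1 else 0) (fun i => ?_) ?_ e f
  · simp [he, hf] at this
  · have := totalSize_nonneg Γ.endSlope
    split_ifs <;> simp only [abs_one, abs_zero] <;> nlinarith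
  · rw [sum_indicator_mul, ← h1, mul_zero]

/-- Parallel branches at `v` span the same line, which relates their moments with coordinates of
their slopes as coefficients. The relation does not involve the ends of a third branch, so
genericity makes these coefficients vanish, against `branchSlope_ne_zero`. -/
theorem area_branchSlope_ne_zero (hgen : IsGeneric Γ.endSlope Γ.moment) {v : Γ.V}
    {b b' : Γ.Branch v} (hne : b ≠ b') : area (branchSlope b) (branchSlope b') ≠ 0 := by
  classical
  intro h0
  have hM := totalSize_nonneg Γ.endSlope
  have h1 := areaHom_branchSlope b
  have h2 := areaHom_branchSlope b'
  rw [areaHom_apply] at h1 h2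
  obtain ⟨e, he⟩ := TropCurve.branchEnds_nonempty b
  obtain ⟨f, hf, hf'⟩ := TropCurve.exists_notMem_branchEnds b b'
  have he' := Finset.disjoint_left.1 (TropCurve.branchEnds_disjoint hne) he
  have h0' : ((branchSlope b).1 : ℝ) * (branchSlope b').2 -
      (branchSlope b).2 * (branchSlope b').1 = 0 := by
    rw [area] at h0
    exact_mod_cast h0
  have key : ∀ k l : ℤ, |k| ≤ totalSize Γ.endSlope → |l| ≤ totalSize Γ.endSlope →
      (k : ℝ) * ∑ e ∈ TropCurve.branchEnds b, Γ.moment e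
        + (l : ℝ) * ∑ e ∈ TropCurve.branchEnds b', Γ.moment e = 0 → k = 0 := by
    intro k l hk hl hkl
    have := hgen (fun i => (if i ∈ TropCurve.branchEnds b then k else 0)
      + (if i ∈ TropCurve.branchEnds b' then l else 0)) (fun i => ?_) ?_ e f
    · simpa [he, he', hf, hf'] using this
    · refine (abs_add_le _ _).trans ?_
      have e1 : |(if i ∈ TropCurve.branchEnds b then k else 0)| ≤ totalSize Γ.endSlope := by
        split_ifs <;> simp [*]
      have e2 : |(if i ∈ TropCurve.branchEnds b' then l else 0)| ≤ totalSize Γ.endSlope := by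
        split_ifs <;> simp [*]
      nlinarith
    · simp only [Int.cast_add, add_mul, Finset.sum_add_distrib, sum_indicator_mul]
      exact hkl
  have hb' := abs_branchSlope_le b'
  have hb := abs_branchSlope_le b
  apply branchSlope_ne_zero hgen b'
  ext
  · refine key _ (-(branchSlope b).1) hb'.1 (by simpa using hb.1) ?_
    rw [← h1, ← h2]
    push_cast
    linear_combination (Γ.pos v).1 * h0'
  · refine key _ (-(branchSlope b).2) hb'.2 (by simpa using hb.2) ?_
    rw [← h1, ← h2]
    push_cast
    linear_combination (Γ.pos v).2 * h0'

theorem not_isFlat (hgen : IsGeneric Γ.endSlope Γ.moment) (v : Γ.V) : ¬ Γ.IsFlat v := by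
  intro hflat
  have hne : (Set.univ : Set (Γ.Branch v)).Nonempty := by
    by_contra hcon
    have := Γ.three_le_valence v
    have h2 := Γ.toTropCurve.valence_eq_card v
    have : IsEmpty (Γ.Branch v) := by
      by_contra h
      rw [not_isEmpty_iff] at h
      exact hcon Set.univ_nonempty
    rw [Nat.card_of_isEmpty, TropCurve.valence] at h2
    omega
  obtain ⟨b, -⟩ := hne
  obtain ⟨b', hne, -⟩ := TropCurve.exists_ne_branch b b
  exact area_branchSlope_ne_zero hgen hne
    (hflat _ (branchSlope_mem_outSlopes b') _ (branchSlope_mem_outSlopes b))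

theorem area_abs_le {a b : CoLat} {N : ℤ} (ha : |a.1| ≤ N ∧ |a.2| ≤ N)
    (hb : |b.1| ≤ N ∧ |b.2| ≤ N) : |area a b| ≤ 2 * N ^ 2 := by
  rw [area]
  refine (abs_sub _ _).trans ?_
  rw [abs_mul, abs_mul]
  have h1 := mul_le_mul ha.1 hb.2 (abs_nonneg _) ((abs_nonneg _).trans ha.1)
  have h2 := mul_le_mul ha.2 hb.1 (abs_nonneg _) ((abs_nonneg _).trans ha.1)
  linarith

/-- With four branches, the relation between three concurrent lines has coefficient zero on the ends
of the fourth. By genericity the areas in it vanish, so two branches are parallel. -/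
theorem valence_eq_three (hgen : IsGeneric Γ.endSlope Γ.moment) (v : Γ.V) : Γ.valence v = 3 := by
  classical
  by_contra hne
  have h4 : 4 ≤ Γ.valence v := by
    have : 3 ≤ Γ.valence v := Γ.three_le_valence v
    omega
  rw [TropCurve.valence_eq_card] at h4
  have : Finite {w // Γ.graph.Adj v w} := Subtype.finite
  have := Fintype.ofFinite (Γ.Branch v)
  rw [Nat.card_eq_fintype_card] at h4
  obtain ⟨f⟩ : Nonempty (Fin 4 ↪ Γ.Branch v) := by
    rw [Function.Embedding.nonempty_iff_card_le]
    simpa using h4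
  have hd : ∀ i j, i ≠ j → Disjoint (TropCurve.branchEnds (f i)) (TropCurve.branchEnds (f j)) :=
    fun i j hij => TropCurve.branchEnds_disjoint (f.injective.ne hij)
  have h01 : f 0 ≠ f 1 := f.injective.ne (by decide)
  have hM := totalSize_nonneg Γ.endSlope
  have hrel := area_branchSlope_relation (f 0) (f 1) (f 2)
  obtain ⟨e, he⟩ := TropCurve.branchEnds_nonempty (f 2)
  obtain ⟨g, hg⟩ := TropCurve.branchEnds_nonempty (f 3)
  have hno : ∀ i j, i ≠ j → ∀ x ∈ TropCurve.branchEnds (f i), x ∉ TropCurve.branchEnds (f j) :=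
    fun i j hij x hx => Finset.disjoint_left.1 (hd i j hij) hx
  have hab : ∀ i j, |area (branchSlope (f i)) (branchSlope (f j))| ≤ 2 * totalSize Γ.endSlope ^ 2 :=
    fun i j => area_abs_le (abs_branchSlope_le _) (abs_branchSlope_le _)
  have := hgen (fun i =>
    (if i ∈ TropCurve.branchEnds (f 0) then area (branchSlope (f 1)) (branchSlope (f 2)) else 0)
    + (if i ∈ TropCurve.branchEnds (f 1) then area (branchSlope (f 2)) (branchSlope (f 0)) else 0)
    + (if i ∈ TropCurve.branchEnds (f 2) then area (branchSlope (f 0)) (branchSlope (f 1)) else 0))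
    (fun i => ?_) ?_ e g
  · rw [if_neg (hno 2 0 (by decide) e he), if_neg (hno 2 1 (by decide) e he), if_pos he,
      if_neg (hno 3 0 (by decide) g hg), if_neg (hno 3 1 (by decide) g hg),
      if_neg (hno 3 2 (by decide) g hg)] at this
    exact area_branchSlope_ne_zero hgen h01 (by simpa using this)
  · have e0 : ∀ j k l, |if i ∈ TropCurve.branchEnds (f j) then
        area (branchSlope (f k)) (branchSlope (f l)) else 0| ≤ 2 * totalSize Γ.endSlope ^ 2 := by
      intro j k l
      split_ifs
      · exact hab k l
      · rw [abs_zero]; positivity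
    refine (abs_add_le _ _).trans ?_
    refine (add_le_add ((abs_add_le _ _).trans (add_le_add (e0 _ _ _) (e0 _ _ _))) (e0 _ _ _)).trans ?_
    nlinarith
  · simp only [Int.cast_add, add_mul, Finset.sum_add_distrib, sum_indicator_mul]
    exact hrel

section Even

variable {r s : ℕ} {n : Fin r → CoLat} {n₁ : CoLat} {Γ₀ : ParamCurve (Fin r ⊕ Fin s)}

/-- Both slopes would be multiples of `n₁`, hence parallel. -/
theorem not_both_even (hgen : IsGeneric Γ₀.endSlope Γ₀.moment)
    (hdeg : Γ₀.endSlope = degreeS s n n₁) {v : Γ₀.V} {b b' : Γ₀.Branch v} (hne : b ≠ b')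
    (hb : ∀ i ∈ TropCurve.branchEnds b, ∃ k, i = Sum.inr k)
    (hb' : ∀ i ∈ TropCurve.branchEnds b', ∃ k, i = Sum.inr k) : False := by
  have key : ∀ c : Γ₀.Branch v, (∀ i ∈ TropCurve.branchEnds c, ∃ k, i = Sum.inr k) →
      ∃ m : ℕ, branchSlope c = m • n₁ := by
    intro c hc
    refine ⟨(TropCurve.branchEnds c).card * 2, ?_⟩
    rw [branchSlope_eq_sum, Finset.sum_congr rfl (g := fun _ => 2 • n₁), Finset.sum_const, mul_smul]
    intro i hi
    obtain ⟨k, rfl⟩ := hc i hi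
    rw [hdeg]
    rfl
  obtain ⟨m, hm⟩ := key b hb
  obtain ⟨m', hm'⟩ := key b' hb'
  apply area_branchSlope_ne_zero hgen hne
  rw [hm, hm', area]
  simp only [Prod.smul_fst, Prod.smul_snd]
  simp only [nsmul_eq_mul]
  ring

theorem exists_inl_mem_beyond (hgen : IsGeneric Γ₀.endSlope Γ₀.moment)
    (hdeg : Γ₀.endSlope = degreeS s n n₁) {x y : Γ₀.V} (h : Γ₀.graph.Adj x y) :
    ¬ ∀ i ∈ Γ₀.beyond x y, ∃ k, i = Sum.inr k := by
  intro hall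
  obtain ⟨b, b', hne, hb, hb'⟩ := TropCurve.exists_two_branches h
  exact not_both_even hgen hdeg hne (fun i hi => hall i (hb hi)) (fun i hi => hall i (hb' hi))

theorem exists_inl_notMem_branchEnds (hgen : IsGeneric Γ₀.endSlope Γ₀.moment)
    (hdeg : Γ₀.endSlope = degreeS s n n₁) {x : Γ₀.V} (b : Γ₀.Branch x) :
    ¬ ∀ i, i ∉ TropCurve.branchEnds b → ∃ k, i = Sum.inr k := by
  intro hall
  obtain ⟨b', hb', -⟩ := TropCurve.exists_ne_branch b b
  obtain ⟨b'', hb'', hne⟩ := TropCurve.exists_ne_branch b b'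
  exact not_both_even hgen hdeg hne
    (fun i hi => hall i (Finset.disjoint_left.1 (TropCurve.branchEnds_disjoint hb'') hi))
    (fun i hi => hall i (Finset.disjoint_left.1 (TropCurve.branchEnds_disjoint hb') hi))

/-- The edge of the curve given by a branch at a vertex. -/
def branchEdge {v : Γ.V} : Γ.Branch v → Sym2 Γ.V ⊕ I
  | Sum.inl w => Sum.inl s(v, w)
  | Sum.inr e => Sum.inr e

theorem branchEdge_injective {v : Γ.V} :
    Function.Injective (branchEdge : Γ.Branch v → Sym2 Γ.V ⊕ I) := by
  rintro (⟨w, h⟩ | ⟨e, h⟩) (⟨w', h'⟩ | ⟨e', h'⟩) heq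
  · simp only [branchEdge, Sum.inl.injEq, Sym2.congr_right] at heq
    subst heq; rfl
  · simp [branchEdge] at heq
  · simp [branchEdge] at heq
  · simp only [branchEdge, Sum.inr.injEq] at heq
    subst heq; rfl

theorem branchEdge_mem_edgesAt {v : Γ.V} (b : Γ.Branch v) : branchEdge b ∈ Γ.edgesAt v := by
  rcases b with ⟨w, h⟩ | ⟨e, h⟩
  · exact Or.inl ⟨w, h, rfl⟩
  · exact Or.inr ⟨e, h, rfl⟩

theorem mem_edgesAt {v : Γ.V} {x : Sym2 Γ.V ⊕ I} :
    x ∈ Γ.edgesAt v ↔ ∃ b : Γ.Branch v, x = branchEdge b := by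
  constructor
  · rintro (⟨w, h, rfl⟩ | ⟨e, h, rfl⟩)
    · exact ⟨Sum.inl ⟨w, h⟩, rfl⟩
    · exact ⟨Sum.inr ⟨e, h⟩, rfl⟩
  · rintro ⟨b, rfl⟩
    exact branchEdge_mem_edgesAt b

theorem evenGraph_eq (hgen : IsGeneric Γ₀.endSlope Γ₀.moment)
    (hdeg : Γ₀.endSlope = degreeS s n n₁) (hn : ∀ j, (n j).IsPrimitive) :
    Γ₀.evenGraph = {x | ∃ k, x = Sum.inr (Sum.inr k)} := by
  ext x
  constructor
  · intro hx
    induction hx with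
    | evenEnd e u h =>
      rcases e with j | k
      · exfalso
        rw [hdeg] at h
        have h' : n j = 2 • u := h
        have hp := hn j
        rw [CoLat.IsPrimitive, h'] at hp
        have h2 := hp.isUnit_of_dvd' (x := 2) (by simp) (by simp)
        exact absurd (Int.isUnit_iff.1 h2) (by decide)
      · exact ⟨k, rfl⟩
    | extend v x hx h ih =>
      exfalso
      obtain ⟨b, rfl⟩ := mem_edgesAt.1 hx
      -- At an extendable vertex all branches but `b` are even ends by induction; there are at least
      -- two of them, and they would be parallel.
      have key : ∀ c : Γ₀.Branch v, c ≠ b → ∀ i ∈ TropCurve.branchEnds c, ∃ k, i = Sum.inr k := by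
        intro c hc i hi
        obtain ⟨k, hk⟩ := ih _ (branchEdge_mem_edgesAt c) (branchEdge_injective.ne hc)
        rcases c with w | ⟨e, he⟩
        · simp [branchEdge] at hk
        · simp only [branchEdge, Sum.inr.injEq] at hk
          rw [TropCurve.branchEnds, Finset.mem_singleton] at hi
          exact ⟨k, hi.trans hk⟩
      obtain ⟨b', hb', -⟩ := TropCurve.exists_ne_branch b b
      obtain ⟨b'', hb'', hne⟩ := TropCurve.exists_ne_branch b b'
      exact not_both_even hgen hdeg hne (key b'' hb'') (key b' hb')
  · rintro ⟨k, rfl⟩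
    exact InEven.evenEnd _ n₁ (by rw [hdeg]; rfl)

end Even

end ParamCurve

end

/-! ### Doubled ends and weights. -/

noncomputable section

variable {r s : ℕ} {E : Type} [Fintype E] {Γ : ParamCurve E} {Γ₀ : ParamCurve (Fin r ⊕ Fin s)}

/-- An identification of the ends of `Γ` with the ends of `Γ₀`, the ends with an index in `Fin s`
being doubled, such that slopes and moments of doubled ends are half of the original ones. -/
structure EndDoubling (Γ : ParamCurve E) (Γ₀ : ParamCurve (Fin r ⊕ Fin s)) where
  equiv : Fin r ⊕ Fin s × Bool ≃ E
  slope_inl : ∀ j, Γ₀.endSlope (Sum.inl j) = Γ.endSlope (equiv (Sum.inl j))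
  slope_inr : ∀ k b, Γ₀.endSlope (Sum.inr k) = (2 : ℤ) • Γ.endSlope (equiv (Sum.inr (k, b)))
  moment_inl : ∀ j, Γ₀.moment (Sum.inl j) = Γ.moment (equiv (Sum.inl j))
  moment_inr : ∀ k b, Γ₀.moment (Sum.inr k) = (2 : ℤ) • Γ.moment (equiv (Sum.inr (k, b)))

namespace EndDoubling

variable (D : EndDoubling Γ Γ₀)

/-- The projection that identifies the two ends of each pair. -/
def proj (e : E) : Fin r ⊕ Fin s := Sum.map id Prod.fst (D.equiv.symm e)

@[simp]
theorem proj_inl (j : Fin r) : D.proj (D.equiv (Sum.inl j)) = Sum.inl j := by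
  simp [proj]

@[simp]
theorem proj_inr (k : Fin s) (b : Bool) : D.proj (D.equiv (Sum.inr (k, b))) = Sum.inr k := by
  simp [proj]

theorem proj_surjective : Function.Surjective D.proj := by
  rintro (j | k)
  · exact ⟨_, D.proj_inl j⟩
  · exact ⟨_, D.proj_inr k true⟩

theorem proj_eq_inl_iff {e : E} {j : Fin r} :
    D.proj e = Sum.inl j ↔ e = D.equiv (Sum.inl j) := by
  obtain ⟨x, rfl⟩ := D.equiv.surjective e
  rcases x with j' | ⟨k, b⟩ <;> simp

theorem proj_eq_inr_iff {e : E} {k : Fin s} :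
    D.proj e = Sum.inr k ↔ e = D.equiv (Sum.inr (k, true)) ∨ e = D.equiv (Sum.inr (k, false)) := by
  obtain ⟨x, rfl⟩ := D.equiv.surjective e
  rcases x with j' | ⟨k, b⟩
  · simp
  · cases b <;> simp

open scoped Classical in
/-- Twice the fraction of an end of `Γ₀` covered by a set of ends of `Γ`. -/
def weight (A : Finset E) : Fin r ⊕ Fin s → ℤ
  | Sum.inl j => if D.equiv (Sum.inl j) ∈ A then 2 else 0
  | Sum.inr k => (if D.equiv (Sum.inr (k, true)) ∈ A then 1 else 0)
      + (if D.equiv (Sum.inr (k, false)) ∈ A then 1 else 0)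

theorem weight_cases (A : Finset E) (i : Fin r ⊕ Fin s) :
    D.weight A i = 0 ∨ D.weight A i = 1 ∨ D.weight A i = 2 := by
  rcases i with j | k <;> simp only [weight] <;> split_ifs <;> simp

theorem weight_inl_ne_one (A : Finset E) (j : Fin r) : D.weight A (Sum.inl j) ≠ 1 := by
  simp only [weight]; split_ifs <;> simp

theorem notMem_of_weight_eq_zero {A : Finset E} {e : E} (h : D.weight A (D.proj e) = 0) :
    e ∉ A := by
  obtain ⟨x, rfl⟩ := D.equiv.surjective e
  rcases x with j | ⟨k, b⟩
  · simpa [weight] using h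
  · cases b <;> simp only [proj_inr, weight] at h <;> split_ifs at h <;> simp_all

theorem mem_of_weight_eq_two {A : Finset E} {e : E} (h : D.weight A (D.proj e) = 2) :
    e ∈ A := by
  obtain ⟨x, rfl⟩ := D.equiv.surjective e
  rcases x with j | ⟨k, b⟩
  · simpa [weight] using h
  · cases b <;> simp only [proj_inr, weight] at h <;> split_ifs at h <;> simp_all

/-- The factor two makes the coefficients integral although one end of a pair is only half an end of
`Γ₀`. Relations between moments of `Γ` thereby become relations to which genericity applies. -/
theorem sum_weight_smul {M : Type*} [AddCommGroup M] (A : Finset E) (g₀ : Fin r ⊕ Fin s → M)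
    (g : E → M) (hl : ∀ j, g₀ (Sum.inl j) = g (D.equiv (Sum.inl j)))
    (hr : ∀ k b, g₀ (Sum.inr k) = (2 : ℤ) • g (D.equiv (Sum.inr (k, b)))) :
    ∑ i, D.weight A i • g₀ i = (2 : ℤ) • ∑ e ∈ A, g e := by
  classical
  have h1 : ∑ e ∈ A, g e = ∑ e, if e ∈ A then g e else 0 := by simp
  rw [h1, ← D.equiv.sum_comp, Fintype.sum_sum_type, Fintype.sum_sum_type, Fintype.sum_prod_type,
    smul_add, Finset.smul_sum, Finset.smul_sum]
  congr 1
  · refine Finset.sum_congr rfl fun j _ => ?_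
    simp only [weight, hl]
    split_ifs <;> simp
  · refine Finset.sum_congr rfl fun k _ => ?_
    simp only [weight, Fintype.sum_bool, add_smul, smul_add]
    congr 1
    · rw [hr k true]; split_ifs <;> simp
    · rw [hr k false]; split_ifs <;> simp

theorem sum_weight_smul_slope (A : Finset E) :
    ∑ i, D.weight A i • Γ₀.endSlope i = (2 : ℤ) • ∑ e ∈ A, Γ.endSlope e :=
  D.sum_weight_smul A _ _ D.slope_inl D.slope_inr

theorem sum_weight_mul_moment (A : Finset E) :
    ∑ i, (D.weight A i : ℝ) * Γ₀.moment i = 2 * ∑ e ∈ A, Γ.moment e := by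
  have := D.sum_weight_smul A _ _ D.moment_inl D.moment_inr
  simpa [zsmul_eq_mul] using this

theorem abs_sum_slope_le (D : EndDoubling Γ Γ₀) (A : Finset E) :
    |(∑ e ∈ A, Γ.endSlope e).1| ≤ totalSize Γ₀.endSlope ∧
      |(∑ e ∈ A, Γ.endSlope e).2| ≤ totalSize Γ₀.endSlope := by
  have h := abs_weighted_sum_le Γ₀.endSlope (D.weight A) 2
    (fun i => by rcases D.weight_cases A i with h | h | h <;> rw [h] <;> simp)
  rw [D.sum_weight_smul_slope] at h
  simpa [abs_mul] using h

/-- A zero slope makes the weight constant. The weight of an undoubled end is never one, so, as `0 <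
r`, the branch would contain either no end or all of them. -/
theorem branchSlope_ne_zero (D : EndDoubling Γ Γ₀) (hgen : IsGeneric Γ₀.endSlope Γ₀.moment)
    (hr : 0 < r) {v : Γ.V} (b : Γ.Branch v) :
    ParamCurve.branchSlope b ≠ 0 := by
  intro h0
  have h1 := ParamCurve.areaHom_branchSlope b
  rw [h0, map_zero] at h1
  have h2 := hgen (D.weight (TropCurve.branchEnds b)) (fun i => ?_) ?_ (Sum.inl ⟨0, hr⟩)
  · rcases D.weight_cases (TropCurve.branchEnds b) (Sum.inl ⟨0, hr⟩) with h | h | h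
    · obtain ⟨e, he⟩ := TropCurve.branchEnds_nonempty b
      exact D.notMem_of_weight_eq_zero ((h2 (D.proj e)).symm.trans h) he
    · exact D.weight_inl_ne_one _ _ h
    · obtain ⟨e, he, -⟩ := TropCurve.exists_notMem_branchEnds b b
      exact he (D.mem_of_weight_eq_two ((h2 (D.proj e)).symm.trans h))
  · have := totalSize_nonneg Γ₀.endSlope
    rcases D.weight_cases (TropCurve.branchEnds b) i with h | h | h <;> rw [h] <;>
      norm_num <;> nlinarith
  · rw [sum_weight_mul_moment, ← h1, mul_zero]

/-- A set of ends of `Γ` and a set of ends of `Γ₀` that span the same line. -/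
theorem weight_eq_iff (D : EndDoubling Γ Γ₀) (hgen : IsGeneric Γ₀.endSlope Γ₀.moment)
    {A : Finset E} {B : Finset (Fin r ⊕ Fin s)}
    {a u : CoLat} (ha : a = ∑ e ∈ A, Γ.endSlope e) (hu : u = ∑ i ∈ B, Γ₀.endSlope i)
    (ha0 : a ≠ 0) (hu0 : u ≠ 0) (harea : area a u = 0)
    (h1 : (u.1 : ℝ) * ∑ e ∈ A, Γ.moment e = (a.1 : ℝ) * ∑ i ∈ B, Γ₀.moment i)
    (h2 : (u.2 : ℝ) * ∑ e ∈ A, Γ.moment e = (a.2 : ℝ) * ∑ i ∈ B, Γ₀.moment i)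
    (i j : Fin r ⊕ Fin s) : D.weight A i = D.weight A j ↔ (i ∈ B ↔ j ∈ B) := by
  have key : ∀ x y : ℤ, |x| ≤ totalSize Γ₀.endSlope → |y| ≤ totalSize Γ₀.endSlope → x ≠ 0 → y ≠ 0 →
      (y : ℝ) * ∑ e ∈ A, Γ.moment e = (x : ℝ) * ∑ i ∈ B, Γ₀.moment i →
      (D.weight A i = D.weight A j ↔ (i ∈ B ↔ j ∈ B)) := by
    intro x y hx hy hx0 hy0 hxy
    have hM := totalSize_nonneg Γ₀.endSlope
    -- Equality of the lines is a relation between the moments of `Γ₀`. As `x` and `y` are nonzero,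
    -- constancy of its coefficients says that the weight and membership in `B` have the same level
    -- sets.
    have hrel := hgen (fun i => y * D.weight A i + if i ∈ B then -2 * x else 0) (fun i => ?_) ?_ i j
    · constructor
      · intro h
        rw [h] at hrel
        by_cases hi : i ∈ B <;> by_cases hj : j ∈ B <;> simp_all
      · intro h
        by_cases hi : i ∈ B <;> by_cases hj : j ∈ B <;> simp_all
    · refine (abs_add_le _ _).trans ?_
      have e1 : |y * D.weight A i| ≤ 2 * totalSize Γ₀.endSlope := by
        rw [abs_mul]
        rcases D.weight_cases A i with h | h | h <;> rw [h] <;> norm_num <;> linarith [abs_nonneg y]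
      have e2 : |if i ∈ B then -2 * x else 0| ≤ 2 * totalSize Γ₀.endSlope := by
        split_ifs
        · rw [abs_mul]; norm_num; exact hx
        · rw [abs_zero]; positivity
      nlinarith
    · simp only [Int.cast_add, add_mul, Finset.sum_add_distrib, ParamCurve.sum_indicator_mul]
      simp only [Int.cast_mul, mul_assoc, ← Finset.mul_sum, sum_weight_mul_moment]
      push_cast
      linear_combination 2 * hxy
  have hab := D.abs_sum_slope_le A
  have hub := abs_sum_le Γ₀.endSlope B
  rw [← ha] at hab
  rw [← hu] at hub
  rw [area] at harea
  -- Nonzero parallel vectors have a common nonzero coordinate, to which `key` is applied.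
  by_cases ha1 : a.1 = 0
  · have ha2 : a.2 ≠ 0 := fun h => ha0 (Prod.ext ha1 h)
    rw [ha1, zero_mul, zero_sub, neg_eq_zero] at harea
    have hu1 := (mul_eq_zero.1 harea).resolve_left ha2
    exact key a.2 u.2 hab.2 hub.2 ha2 (fun h => hu0 (Prod.ext hu1 h)) h2
  · have hu1 : u.1 ≠ 0 := by
      intro hu1
      rw [hu1, mul_zero, sub_zero] at harea
      exact hu0 (Prod.ext hu1 ((mul_eq_zero.1 harea).resolve_left ha1))
    exact key a.1 u.1 hab.1 hub.1 ha1 hu1 h1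

theorem exists_inr_of_weight_eq_one {A : Finset E} {i : Fin r ⊕ Fin s} (h : D.weight A i = 1) :
    ∃ k, i = Sum.inr k := by
  rcases i with j | k
  · exact absurd h (D.weight_inl_ne_one A j)
  · exact ⟨k, rfl⟩

/-- The weight has one value on `B` and another one outside, both among 0, 1, 2. Without the value
1, `A` is the preimage of `B` or of its complement; the value 1 can only occur on doubled ends. -/
theorem cases_of_weight_eq_iff {A : Finset E} {B : Finset (Fin r ⊕ Fin s)}
    (h : ∀ i j, D.weight A i = D.weight A j ↔ (i ∈ B ↔ j ∈ B)) (hB : B.Nonempty)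
    (hBc : ∃ i, i ∉ B) :
    (∀ e, e ∈ A ↔ D.proj e ∈ B) ∨ (∀ e, e ∈ A ↔ D.proj e ∉ B) ∨
    ((∀ i ∈ B, D.weight A i = 1) ∧ ((∀ i, i ∉ B → D.weight A i = 0) ∨
      (∀ i, i ∉ B → D.weight A i = 2))) ∨ ∀ i, i ∉ B → ∃ k, i = Sum.inr k := by
  obtain ⟨i, hi⟩ := hB
  obtain ⟨j, hj⟩ := hBc
  have hne : D.weight A i ≠ D.weight A j := fun hw => hj (((h i j).1 hw).1 hi)
  have hin : ∀ i' ∈ B, D.weight A i' = D.weight A i := fun i' hi' => (h i' i).2 (by simp [hi, hi'])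
  have hout : ∀ j', j' ∉ B → D.weight A j' = D.weight A j :=
    fun j' hj' => (h j' j).2 (by simp [hj, hj'])
  by_cases hj1 : D.weight A j = 1
  · refine Or.inr (Or.inr (Or.inr fun j' hj' => ?_))
    exact D.exists_inr_of_weight_eq_one ((hout j' hj').trans hj1)
  by_cases hi1 : D.weight A i = 1
  · refine Or.inr (Or.inr (Or.inl ⟨fun i' hi' => (hin i' hi').trans hi1, ?_⟩))
    rcases D.weight_cases A j with h0 | h0 | h0
    · exact Or.inl fun j' hj' => (hout j' hj').trans h0
    · exact absurd h0 hj1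
    · exact Or.inr fun j' hj' => (hout j' hj').trans h0
  rcases D.weight_cases A i with h0 | h0 | h0
  · right; left
    intro e
    by_cases he : D.proj e ∈ B
    · simp [he, D.notMem_of_weight_eq_zero ((hin _ he).trans h0)]
    · rcases D.weight_cases A j with h0' | h0' | h0'
      · exact absurd (h0.trans h0'.symm) hne
      · exact absurd h0' hj1
      · simp [he, D.mem_of_weight_eq_two ((hout _ he).trans h0')]
  · exact absurd h0 hi1
  · left
    intro e
    by_cases he : D.proj e ∈ B
    · simp [he, D.mem_of_weight_eq_two ((hin _ he).trans h0)]
    · rcases D.weight_cases A j with h0' | h0' | h0'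
      · simp [he, D.notMem_of_weight_eq_zero ((hout _ he).trans h0')]
      · exact absurd h0' hj1
      · exact absurd (h0.trans h0'.symm) hne

end EndDoubling

end

/-! ### Matching a curve with `Γ₀`. -/

noncomputable section

variable {r s : ℕ} {n : Fin r → CoLat} {n₁ : CoLat} {E : Type} [Fintype E] {Γ : ParamCurve E}
  {Γ₀ : ParamCurve (Fin r ⊕ Fin s)}

namespace EndDoubling

variable (D : EndDoubling Γ Γ₀)

theorem eq_of_weight_inr_eq_one {A : Finset E} {k : Fin s} (h : D.weight A (Sum.inr k) = 1) :
    ∃ b, D.equiv (Sum.inr (k, b)) ∈ A ∧ D.equiv (Sum.inr (k, !b)) ∉ A := by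
  simp only [weight] at h
  by_cases h1 : D.equiv (Sum.inr (k, true)) ∈ A
  · refine ⟨true, h1, fun h2 => ?_⟩
    rw [if_pos h1, if_pos (Bool.not_true ▸ h2)] at h
    norm_num at h
  · refine ⟨false, ?_, h1⟩
    by_contra h2
    rw [if_neg h1, if_neg h2] at h
    norm_num at h

theorem not_nontrivial_of_weight {A : Finset E} {k : Fin s}
    (h1 : D.weight A (Sum.inr k) = 1) (h0 : ∀ i, i ≠ Sum.inr k → D.weight A i = 0) :
    ¬ A.Nontrivial := by
  obtain ⟨b, hb, hb'⟩ := D.eq_of_weight_inr_eq_one h1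
  have key : ∀ e ∈ A, e = D.equiv (Sum.inr (k, b)) := by
    intro e he
    by_cases hk : D.proj e = Sum.inr k
    · rw [proj_eq_inr_iff] at hk
      cases b <;> rcases hk with hk | hk <;> first | exact hk | exact absurd (hk ▸ he) hb'
    · exact absurd he (D.notMem_of_weight_eq_zero (h0 _ hk))
  rintro ⟨e, he, f, hf, hne⟩
  exact hne ((key e he).trans (key f hf).symm)

theorem not_nontrivial_of_weight_compl {A A' : Finset E} {k : Fin s}
    (h1 : D.weight A (Sum.inr k) = 1) (h0 : ∀ i, i ≠ Sum.inr k → D.weight A i = 2)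
    (hA : ∀ e ∈ A', e ∉ A) : ¬ A'.Nontrivial := by
  obtain ⟨b, hb, hb'⟩ := D.eq_of_weight_inr_eq_one h1
  have key : ∀ e ∈ A', e = D.equiv (Sum.inr (k, !b)) := by
    intro e he
    by_cases hk : D.proj e = Sum.inr k
    · rw [proj_eq_inr_iff] at hk
      cases b <;> rcases hk with hk | hk <;> first | exact hk | exact absurd (hk ▸ hb) (hA e he)
    · exact absurd (D.mem_of_weight_eq_two (h0 _ hk)) (hA e he)
  rintro ⟨e, he, f, hf, hne⟩
  exact hne ((key e he).trans (key f hf).symm)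

theorem not_forall_even_beyond (hgen : IsGeneric Γ₀.endSlope Γ₀.moment)
    (hdeg : Γ₀.endSlope = degreeS s n n₁) {x y : Γ₀.V} (hxy : Γ₀.graph.Adj x y) {A : Finset E}
    (h : ∀ i ∈ Γ₀.beyond x y, D.weight A i = 1) : False :=
  ParamCurve.exists_inl_mem_beyond hgen hdeg hxy
    fun i hi => D.exists_inr_of_weight_eq_one (h i hi)

/-- Genericity leaves only one kind of bounded edge of `Γ` without counterpart in `Γ₀`: one that
cuts off the two ends of a pair and lies over the corresponding even end. This is what `hpair` rules
out. -/
theorem exists_sameSplit (D : EndDoubling Γ Γ₀) (hgen : IsGeneric Γ₀.endSlope Γ₀.moment)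
    (hdeg : Γ₀.endSlope = degreeS s n n₁) (hr : 0 < r) (himage : Γ.image ⊆ Γ₀.image)
    (hpair : ∀ v w k, Γ.graph.Adj v w → ¬ ∀ e, e ∈ Γ.beyond v w ↔ D.proj e = Sum.inr k)
    {v w : Γ.V} (hvw : Γ.graph.Adj v w) :
    ∃ x y, Γ₀.graph.Adj x y ∧ ∀ e, e ∈ Γ.beyond v w ↔ D.proj e ∈ Γ₀.beyond x y := by
  have hs := D.branchSlope_ne_zero hgen hr (v := v) (Sum.inl ⟨w, hvw⟩)
  obtain ⟨x, b, harea, h1, h2⟩ := ParamCurve.exists_branch_of_image_subset himage hvw hs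
  have hW := D.weight_eq_iff hgen (ParamCurve.slope_eq_sum hvw) (ParamCurve.branchSlope_eq_sum b)
    hs (ParamCurve.branchSlope_ne_zero hgen b) harea h1 h2
  obtain ⟨i₀, hi₀, -⟩ := TropCurve.exists_notMem_branchEnds b b
  rcases D.cases_of_weight_eq_iff hW (TropCurve.branchEnds_nonempty b) ⟨i₀, hi₀⟩ with
    h | h | ⟨h, h'⟩ | h
  · rcases b with ⟨y, hxy⟩ | ⟨i, hi⟩
    · exact ⟨x, y, hxy, h⟩
    · exfalso
      simp only [TropCurve.branchEnds, Finset.mem_singleton] at h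
      rcases i with j | k
      · obtain ⟨e, he, f, hf, hne⟩ := TropCurve.beyond_nontrivial hvw
        rw [Finset.mem_coe, h, proj_eq_inl_iff] at he hf
        exact hne (he.trans hf.symm)
      · exact hpair v w k hvw h
  · rcases b with ⟨y, hxy⟩ | ⟨i, hi⟩
    · refine ⟨y, x, hxy.symm, fun e => ?_⟩
      rw [h, TropCurve.mem_beyond_symm hxy]
      rfl
    · exfalso
      simp only [TropCurve.branchEnds, Finset.mem_singleton] at h
      have h' : ∀ e, e ∈ Γ.beyond w v ↔ D.proj e = i := by
        intro e
        rw [TropCurve.mem_beyond_symm hvw, h, not_not]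
      rcases i with j | k
      · obtain ⟨e, he, f, hf, hne⟩ := TropCurve.beyond_nontrivial hvw.symm
        rw [Finset.mem_coe, h', proj_eq_inl_iff] at he hf
        exact hne (he.trans hf.symm)
      · exact hpair w v k hvw.symm h'
  -- Weight one on `B` makes `B` consist of even ends, hence of a single one. The edge of `Γ` would
  -- then cut off a single end, but there are at least two ends on each side.
  · exfalso
    rcases b with ⟨y, hxy⟩ | ⟨i, hi⟩
    · exact D.not_forall_even_beyond hgen hdeg hxy h
    · simp only [TropCurve.branchEnds, Finset.mem_singleton, forall_eq] at h h'
      obtain ⟨k, rfl⟩ := D.exists_inr_of_weight_eq_one h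
      rcases h' with h' | h'
      · exact D.not_nontrivial_of_weight h h' (TropCurve.beyond_nontrivial hvw)
      · exact D.not_nontrivial_of_weight_compl h h'
          (fun e he => (TropCurve.mem_beyond_symm hvw).1 he)
          (TropCurve.beyond_nontrivial hvw.symm)
  · exact absurd h (ParamCurve.exists_inl_notMem_branchEnds hgen hdeg b)

theorem exists_sameSplit_symm (D : EndDoubling Γ Γ₀) (hgen : IsGeneric Γ₀.endSlope Γ₀.moment)
    (hdeg : Γ₀.endSlope = degreeS s n n₁) (hr : 0 < r) (himage : Γ₀.image ⊆ Γ.image)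
    {x y : Γ₀.V} (hxy : Γ₀.graph.Adj x y) :
    ∃ v w, Γ.graph.Adj v w ∧ ∀ e, e ∈ Γ.beyond v w ↔ D.proj e ∈ Γ₀.beyond x y := by
  have hs := ParamCurve.branchSlope_ne_zero hgen (v := x) (Sum.inl ⟨y, hxy⟩)
  obtain ⟨v, b, harea, h1, h2⟩ := ParamCurve.exists_branch_of_image_subset himage hxy hs
  have hW := D.weight_eq_iff hgen (ParamCurve.branchSlope_eq_sum b) (ParamCurve.slope_eq_sum hxy)
    (D.branchSlope_ne_zero hgen hr b) hs
    (by rw [area] at harea ⊢; simp only [ParamCurve.branchSlope] at harea ⊢; linarith)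
    h1.symm h2.symm
  -- This excludes that the line is spanned by a single end of `Γ`: both sides of a bounded edge of
  -- `Γ₀` have several ends, hence several preimages.
  have hpre : ∀ B : Finset (Fin r ⊕ Fin s), B.Nontrivial → ∀ e₀, ¬ ∀ i ∈ B, ∀ e, D.proj e = i →
      e = e₀ := by
    rintro B ⟨i, hi, j, hj, hne⟩ e₀ hall
    obtain ⟨e, rfl⟩ := D.proj_surjective i
    obtain ⟨f, rfl⟩ := D.proj_surjective j
    exact hne (by rw [hall _ hi e rfl, hall _ hj f rfl])
  obtain ⟨i₀, hi₀⟩ := TropCurve.beyond_nonempty hxy.symm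
  rcases D.cases_of_weight_eq_iff hW (TropCurve.beyond_nonempty hxy)
    ⟨i₀, (TropCurve.mem_beyond_symm hxy).1 hi₀⟩ with h | h | ⟨h, h'⟩ | h
  · rcases b with ⟨w, hvw⟩ | ⟨e₀, he₀⟩
    · exact ⟨v, w, hvw, h⟩
    · exfalso
      simp only [TropCurve.branchEnds, Finset.mem_singleton] at h
      refine hpre _ (TropCurve.beyond_nontrivial hxy) e₀ fun i hi e he => ?_
      rw [h, he]; exact hi
  · rcases b with ⟨w, hvw⟩ | ⟨e₀, he₀⟩
    · refine ⟨w, v, hvw.symm, fun e => ?_⟩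
      rw [TropCurve.mem_beyond_symm hvw, ← not_iff_not, not_not]
      exact h e
    · exfalso
      simp only [TropCurve.branchEnds, Finset.mem_singleton] at h
      refine hpre _ (TropCurve.beyond_nontrivial hxy.symm) e₀ fun i hi e he => ?_
      rw [h, he]; exact (TropCurve.mem_beyond_symm hxy).1 hi
  · exact (D.not_forall_even_beyond hgen hdeg hxy h).elim
  · exact absurd (fun i hi => h i ((TropCurve.mem_beyond_symm hxy).1 hi))
      (ParamCurve.exists_inl_mem_beyond hgen hdeg hxy.symm)

theorem sameSplits (D : EndDoubling Γ Γ₀) (hgen : IsGeneric Γ₀.endSlope Γ₀.moment)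
    (hdeg : Γ₀.endSlope = degreeS s n n₁) (hr : 0 < r) (himage : Γ.image = Γ₀.image)
    (hpair : ∀ v w k, Γ.graph.Adj v w → ¬ ∀ e, e ∈ Γ.beyond v w ↔ D.proj e = Sum.inr k) :
    TropCurve.SameSplits Γ.toTropCurve Γ₀.toTropCurve (fun e i => D.proj e = i) where
  left_total e := ⟨_, rfl⟩
  right_total i := D.proj_surjective i
  left v w hvw := by
    obtain ⟨x, y, hxy, h⟩ := D.exists_sameSplit hgen hdeg hr himage.subset hpair hvw
    exact ⟨x, y, hxy, fun e i hi => hi ▸ h e⟩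
  right x y hxy := by
    obtain ⟨v, w, hvw, h⟩ := D.exists_sameSplit_symm hgen hdeg hr himage.superset hxy
    exact ⟨v, w, hvw, fun e i hi => hi ▸ h e⟩

theorem sum_eq_of_mem_iff {M : Type*} [AddCommGroup M] [IsAddTorsionFree M] {A : Finset E}
    {B : Finset (Fin r ⊕ Fin s)} (hAB : ∀ e, e ∈ A ↔ D.proj e ∈ B) (g₀ : Fin r ⊕ Fin s → M)
    (g : E → M) (hl : ∀ j, g₀ (Sum.inl j) = g (D.equiv (Sum.inl j)))
    (hr : ∀ k b, g₀ (Sum.inr k) = (2 : ℤ) • g (D.equiv (Sum.inr (k, b)))) :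
    ∑ e ∈ A, g e = ∑ i ∈ B, g₀ i := by
  classical
  have h := D.sum_weight_smul A g₀ g hl hr
  have hw : ∀ i, D.weight A i = if i ∈ B then 2 else 0 := by
    rintro (j | k) <;> simp only [weight, hAB, proj_inl, proj_inr]
    split_ifs <;> simp
  simp only [hw, ite_smul, zero_smul, Finset.sum_ite_mem, Finset.univ_inter, ← Finset.smul_sum] at h
  exact (zsmul_right_injective (two_ne_zero) h).symm

/-- An identification of the underlying metric trees, compatible with the maps to the plane and
with the ends. -/
structure Matching (D : EndDoubling Γ Γ₀) where
  onV : Γ.V ≃ Γ₀.V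
  adj_iff : ∀ v w, Γ₀.graph.Adj (onV v) (onV w) ↔ Γ.graph.Adj v w
  attach_eq : ∀ e, Γ₀.attach (D.proj e) = onV (Γ.attach e)
  sameSplit : ∀ v w, Γ.graph.Adj v w →
    ∀ e, e ∈ Γ.beyond v w ↔ D.proj e ∈ Γ₀.beyond (onV v) (onV w)

theorem exists_matching (hS : TropCurve.SameSplits Γ.toTropCurve Γ₀.toTropCurve
    (fun e i => D.proj e = i)) : Nonempty D.Matching := by
  obtain ⟨φ, h1, h2, h3⟩ := hS.exists_equiv
  exact ⟨⟨φ, h1, fun e => h2 e _ rfl, fun v w h e => h3 v w h e _ rfl⟩⟩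

namespace Matching

variable {D} (m : D.Matching)

theorem slope_eq {v w : Γ.V} (h : Γ.graph.Adj v w) :
    Γ₀.slope (m.onV v) (m.onV w) = Γ.slope v w := by
  rw [ParamCurve.slope_eq_sum ((m.adj_iff v w).2 h), ParamCurve.slope_eq_sum h]
  exact (D.sum_eq_of_mem_iff (m.sameSplit v w h) _ _ D.slope_inl D.slope_inr).symm

theorem exists_branch {v : Γ.V} (b₀ : Γ₀.Branch (m.onV v)) :
    ∃ (b : Γ.Branch v) (k : ℤ), ParamCurve.branchSlope b₀ = k • ParamCurve.branchSlope b ∧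
      areaHom (Γ.pos v) (ParamCurve.branchSlope b₀) =
        areaHom (Γ₀.pos (m.onV v)) (ParamCurve.branchSlope b₀) := by
  rcases b₀ with ⟨y, hy⟩ | ⟨i, hi⟩
  · obtain ⟨w, rfl⟩ := m.onV.surjective y
    have hvw := (m.adj_iff v w).1 hy
    refine ⟨Sum.inl ⟨w, hvw⟩, 1, ?_, ?_⟩
    · simpa [ParamCurve.branchSlope] using m.slope_eq hvw
    · rw [ParamCurve.areaHom_branchSlope]
      simp only [ParamCurve.branchSlope, m.slope_eq hvw, TropCurve.branchEnds]
      rw [ParamCurve.areaHom_slope_eq_sum hvw]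
      exact D.sum_eq_of_mem_iff (m.sameSplit v w hvw) _ _ D.moment_inl D.moment_inr
  · obtain ⟨e, rfl⟩ := D.proj_surjective i
    have he : Γ.attach e = v := m.onV.injective ((m.attach_eq e).symm.trans hi)
    have key : ∃ k : ℤ, Γ₀.endSlope (D.proj e) = k • Γ.endSlope e ∧
        Γ₀.moment (D.proj e) = k • Γ.moment e := by
      obtain ⟨x, rfl⟩ := D.equiv.surjective e
      rcases x with j | ⟨k, b⟩
      · exact ⟨1, by rw [proj_inl, D.slope_inl, one_smul], by rw [proj_inl, D.moment_inl, one_smul]⟩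
      · exact ⟨2, by rw [proj_inr, D.slope_inr k b], by rw [proj_inr, D.moment_inr k b]⟩
    obtain ⟨k, hk, hk'⟩ := key
    refine ⟨Sum.inr ⟨e, he⟩, k, hk, ?_⟩
    rw [ParamCurve.areaHom_branchSlope]
    simp only [ParamCurve.branchSlope, TropCurve.branchEnds, Finset.sum_singleton, hk, map_zsmul, hk']
    subst he
    rfl

theorem exists_two_branches (v : Γ₀.V) : ∃ b b' : Γ₀.Branch v, b ≠ b' := by
  have : Nonempty (Γ₀.Branch v) := by
    by_contra h
    rw [not_nonempty_iff] at h
    have h3 : 3 ≤ Γ₀.valence v := Γ₀.three_le_valence v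
    rw [TropCurve.valence_eq_card, Nat.card_of_isEmpty] at h3
    omega
  obtain ⟨b⟩ := this
  obtain ⟨b', hb', -⟩ := TropCurve.exists_ne_branch b b
  exact ⟨b', b, hb'⟩

/-- Both points lie on the lines of two branches of `Γ₀`, and these lines are transverse. -/
theorem pos_eq (m : D.Matching) (hgen : IsGeneric Γ₀.endSlope Γ₀.moment) (v : Γ.V) :
    Γ₀.pos (m.onV v) = Γ.pos v := by
  obtain ⟨b, b', hne⟩ := exists_two_branches (m.onV v)
  have harea := ParamCurve.area_branchSlope_ne_zero hgen hne
  obtain ⟨-, -, -, h1⟩ := m.exists_branch b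
  obtain ⟨-, -, -, h2⟩ := m.exists_branch b'
  rw [areaHom_apply, areaHom_apply] at h1 h2
  generalize ParamCurve.branchSlope b = u at *
  generalize ParamCurve.branchSlope b' = u' at *
  have harea' : (u.1 : ℝ) * u'.2 - u.2 * u'.1 ≠ 0 := by
    rw [area] at harea
    exact_mod_cast harea
  ext
  · apply mul_left_cancel₀ harea'
    linear_combination (u.1 : ℝ) * h2 - (u'.1 : ℝ) * h1
  · apply mul_left_cancel₀ harea'
    linear_combination (u.2 : ℝ) * h2 - (u'.2 : ℝ) * h1

theorem len_eq (m : D.Matching) (hgen : IsGeneric Γ₀.endSlope Γ₀.moment) {v w : Γ.V}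
    (h : Γ.graph.Adj v w) : Γ₀.len (m.onV v) (m.onV w) = Γ.len v w := by
  have h0 := (m.adj_iff v w).2 h
  have h1 := Γ.pos_sub v w h
  have h2 := Γ₀.pos_sub _ _ h0
  rw [m.pos_eq hgen, m.pos_eq hgen, h1, m.slope_eq h] at h2
  have hne : Γ.slope v w ≠ 0 := by
    rw [← m.slope_eq h]
    exact ParamCurve.branchSlope_ne_zero hgen (Sum.inl ⟨_, h0⟩)
  refine (smul_left_injective ℝ ?_ h2).symm
  intro hz
  exact hne (toPlane_injective (hz.trans (by simp [CoLat.toPlane, Prod.zero_eq_mk])))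

theorem not_isFlat (m : D.Matching) (hgen : IsGeneric Γ₀.endSlope Γ₀.moment) (v : Γ.V) :
    ¬ Γ.IsFlat v := by
  intro hflat
  obtain ⟨b, b', hne⟩ := exists_two_branches (m.onV v)
  apply ParamCurve.area_branchSlope_ne_zero hgen hne
  obtain ⟨c, k, h1, -⟩ := m.exists_branch b
  obtain ⟨c', k', h2, -⟩ := m.exists_branch b'
  have h3 := hflat _ (ParamCurve.branchSlope_mem_outSlopes c) _
    (ParamCurve.branchSlope_mem_outSlopes c')
  rw [area] at h3
  rw [h1, h2, area]
  simp only [Prod.smul_fst, Prod.smul_snd, smul_eq_mul]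
  linear_combination k * k' * h3

/-- The corresponding vertex of `Γ₀` is trivalent and carries only one even end, since two would be
parallel. Doubling this end adds exactly one to the valence. -/
theorem valence_eq_four (m : D.Matching) (hgen : IsGeneric Γ₀.endSlope Γ₀.moment)
    (hdeg : Γ₀.endSlope = degreeS s n n₁) (k : Fin s) (b : Bool) :
    Γ.valence (Γ.attach (D.equiv (Sum.inr (k, b)))) = 4 := by
  set v := Γ.attach (D.equiv (Sum.inr (k, b))) with hv
  have h3 := ParamCurve.valence_eq_three hgen (m.onV v)
  rw [TropCurve.valence] at h3 ⊢
  have hk : Γ₀.attach (Sum.inr k) = m.onV v := by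
    rw [hv, ← m.attach_eq, proj_inr]
  have hnbr : m.onV '' (Γ.graph.neighborSet v) = Γ₀.graph.neighborSet (m.onV v) := by
    ext y
    obtain ⟨w, rfl⟩ := m.onV.surjective y
    simp [m.adj_iff]
  rw [← hnbr, Set.ncard_image_of_injective _ m.onV.injective] at h3
  let g : Fin r ⊕ Fin s → E := fun i => D.equiv (Sum.map id (fun k => (k, b)) i)
  have hg : Function.LeftInverse D.proj g := by
    rintro (j | k') <;> simp [g]
  have hends : {e | Γ.attach e = v} =
      insert (D.equiv (Sum.inr (k, !b))) (g '' {i | Γ₀.attach i = m.onV v}) := by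
    ext e
    obtain ⟨x, rfl⟩ := D.equiv.surjective e
    have hx : ∀ e, Γ.attach e = v ↔ Γ₀.attach (D.proj e) = m.onV v := by
      intro e
      rw [m.attach_eq]
      exact m.onV.injective.eq_iff.symm
    rw [Set.mem_ofPred_eq, Set.mem_insert_iff, hx]
    constructor
    · intro h
      rcases x with j | ⟨k', b'⟩
      · exact Or.inr ⟨Sum.inl j, by simpa using h, rfl⟩
      · rw [proj_inr] at h
        have hkk : k' = k := by
          by_contra hne
          refine ParamCurve.not_both_even hgen hdeg (b := Sum.inr ⟨Sum.inr k', h⟩)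
            (b' := Sum.inr ⟨Sum.inr k, hk⟩) (by simpa using hne) ?_ ?_ <;>
            simp [TropCurve.branchEnds]
        subst hkk
        by_cases hb : b' = b
        · subst hb
          exact Or.inr ⟨Sum.inr k', h, rfl⟩
        · left
          rw [Bool.eq_not_of_ne hb]
    · rintro (h | ⟨i, hi, h⟩)
      · rw [h, proj_inr, hk]
      · rw [← h, hg]; exact hi
  rw [hends, Set.ncard_insert_of_notMem, Set.ncard_image_of_injective _ hg.injective]
  · omega
  · rintro ⟨i, -, hi⟩
    have h2 := D.equiv.injective hi
    rcases i with j | k'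
    · simp at h2
    · simp at h2

/-- A real structure that only exchanges the two ends of each pair fixes all vertices. -/
theorem onV_eq (m : D.Matching) (σ : RealStructure Γ) (hσ : ∀ e, D.proj (σ.onE e) = D.proj e)
    (v : Γ.V) : σ.onV v = v :=
  TropCurve.automorphism_eq_id (Γ := Γ.toTropCurve) ⟨σ.onV, fun {a b} => σ.adj_iff a b⟩ σ.onE
    σ.attach_eq (fun v w h e => by rw [m.sameSplit v w h, m.sameSplit v w h, hσ]) v

end Matching

end EndDoubling

end

noncomputable section

/-! ### Orders and leading coefficients of Laurent series -/

theorem order_leadingCoeff_of_coeff {x : Ser} {k : ℤ} (h : ∀ j < k, x.coeff j = 0)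
    (hk : x.coeff k ≠ 0) : x ≠ 0 ∧ x.order = k ∧ x.leadingCoeff = x.coeff k := by
  have hx : x ≠ 0 := by
    rintro rfl
    exact hk rfl
  have ho : x.order = k := by
    refine le_antisymm (HahnSeries.order_le_of_coeff_ne_zero hk) (not_lt.1 fun hlt => ?_)
    have := h _ hlt
    rw [← HahnSeries.leadingCoeff_eq] at this
    exact hx (HahnSeries.leadingCoeff_eq_zero.1 this)
  exact ⟨hx, ho, by rw [HahnSeries.leadingCoeff_eq, ho]⟩

theorem coeff_order_ne_zero {x : Ser} (hx : x ≠ 0) : x.coeff x.order ≠ 0 := by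
  rw [← HahnSeries.leadingCoeff_eq]
  exact HahnSeries.leadingCoeff_ne_zero.2 hx

theorem order_zpow {x : Ser} (hx : x ≠ 0) (k : ℤ) : (x ^ k).order = k * x.order := by
  have hinv : (x⁻¹).order = -x.order := by
    have := HahnSeries.order_mul hx (inv_ne_zero hx)
    rw [mul_inv_cancel₀ hx, HahnSeries.order_one] at this
    omega
  cases k with
  | ofNat m => simp
  | negSucc m =>
    rw [zpow_negSucc, ← inv_pow, HahnSeries.order_pow, hinv, Int.negSucc_eq]
    simp only [nsmul_eq_mul]
    push_cast
    ring

theorem order_prod_zpow {ι : Type*} (t : Finset ι) (x : ι → Ser) (k : ι → ℤ)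
    (h : ∀ i ∈ t, x i ≠ 0 ∨ k i = 0) :
    (∏ i ∈ t, x i ^ k i) ≠ 0 ∧ (∏ i ∈ t, x i ^ k i).order = ∑ i ∈ t, k i * (x i).order := by
  classical
  induction t using Finset.induction_on with
  | empty => simp
  | insert a t ha ih =>
    obtain ⟨ih1, ih2⟩ := ih fun i hi => h i (Finset.mem_insert_of_mem hi)
    rw [Finset.prod_insert ha, Finset.sum_insert ha]
    have h0 : x a ^ k a ≠ 0 ∧ (x a ^ k a).order = k a * (x a).order := by
      rcases h a (Finset.mem_insert_self _ _) with h | h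
      · exact ⟨zpow_ne_zero _ h, order_zpow h _⟩
      · simp [h]
    exact ⟨mul_ne_zero h0.1 ih1, by rw [HahnSeries.order_mul h0.1 ih1, h0.2, ih2]⟩

/-- The leading coefficient of a Laurent series, as a multiplicative map. -/
def leadingCoeffHom : Ser →*₀ ℂ where
  toFun x := x.leadingCoeff
  map_zero' := HahnSeries.leadingCoeff_zero
  map_one' := HahnSeries.leadingCoeff_one
  map_mul' x y := HahnSeries.leadingCoeff_mul x y

theorem leadingCoeffHom_apply (x : Ser) : leadingCoeffHom x = x.leadingCoeff := rfl

/-- Conjugation of Laurent series as a ring homomorphism. -/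
def conjSerHom : Ser →+* Ser where
  toFun := conjSer
  map_zero' := by ext; simp [conjSer]
  map_one' := by
    ext j
    simp only [conjSer, HahnSeries.map_coeff, HahnSeries.coeff_one]
    split_ifs <;> simp
  map_add' x y := by ext; simp [conjSer]
  map_mul' x y := HahnSeries.map_mul (x := x) (y := y)
    ((starRingEnd ℂ : ℂ →+* ℂ) : ℂ →ₙ+* ℂ)

theorem conjSerHom_apply (x : Ser) : conjSerHom x = conjSer x := rfl

/-! ### Specialization of points -/

theorem specialize_eq_infty_iff {c a : Ser} {ρ : ℤ} :
    specialize c ρ a = OnePoint.infty ↔ a - c ≠ 0 ∧ (a - c).order < ρ := by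
  rw [specialize]
  split_ifs with h
  · simp only [OnePoint.coe_ne_infty, false_iff, not_and, not_lt]
    intro hne
    by_contra hlt
    exact coeff_order_ne_zero hne (h _ (not_le.1 hlt))
  · simp only [true_iff]
    push Not at h
    obtain ⟨k, hk, hk'⟩ := h
    refine ⟨?_, (HahnSeries.order_le_of_coeff_ne_zero hk').trans_lt hk⟩
    intro h0
    rw [h0] at hk'
    exact hk' rfl

theorem specialize_eq_coe_iff {c a : Ser} {ρ : ℤ} {z : ℂ} :
    specialize c ρ a = (z : OnePoint ℂ) ↔
      (∀ k < ρ, (a - c).coeff k = 0) ∧ (a - c).coeff ρ = z := by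
  rw [specialize]
  split_ifs with h
  · simp only [OnePoint.coe_eq_coe, iff_and_self]
    exact fun _ => h
  · simp only [OnePoint.infty_ne_coe, false_iff]
    exact fun h' => h h'.1

theorem ordAlong_of_coe {c a : Ser} {ρ : ℤ} {z : ℂ} (h : specialize c ρ a = (z : OnePoint ℂ)) :
    ordAlong c ρ a = ρ := by
  rw [ordAlong]
  split_ifs with hca
  · rfl
  · rw [min_eq_left]
    by_contra hlt
    have : specialize c ρ a = OnePoint.infty :=
      specialize_eq_infty_iff.2 ⟨sub_ne_zero.2 (Ne.symm hca), by
        rw [← HahnSeries.order_neg, neg_sub]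
        exact not_le.1 hlt⟩
    rw [h] at this
    exact OnePoint.coe_ne_infty z this

theorem ordAlong_of_infty {c a : Ser} {ρ : ℤ} (h : specialize c ρ a = OnePoint.infty) :
    ordAlong c ρ a = (a - c).order := by
  obtain ⟨h1, h2⟩ := specialize_eq_infty_iff.1 h
  rw [ordAlong, if_neg (sub_ne_zero.1 h1).symm, min_eq_right] <;>
    rw [← HahnSeries.order_neg, neg_sub]
  exact h2.le

theorem sub_of_coe_coe {c a b : Ser} {ρ : ℤ} {x y : ℂ} (ha : specialize c ρ a = (x : OnePoint ℂ))
    (hb : specialize c ρ b = (y : OnePoint ℂ)) (hne : x ≠ y) :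
    (a - b).order = ρ ∧ (a - b).leadingCoeff = x - y := by
  obtain ⟨h1, h2⟩ := specialize_eq_coe_iff.1 ha
  obtain ⟨h3, h4⟩ := specialize_eq_coe_iff.1 hb
  have key : ∀ k, (a - b).coeff k = (a - c).coeff k - (b - c).coeff k := fun k => by
    rw [← HahnSeries.coeff_sub, sub_sub_sub_cancel_right]
  obtain ⟨-, h5, h6⟩ := order_leadingCoeff_of_coeff (x := a - b) (k := ρ)
    (fun j hj => by rw [key, h1 j hj, h3 j hj, sub_zero])
    (by rw [key, h2, h4]; exact sub_ne_zero.2 hne)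
  exact ⟨h5, by rw [h6, key, h2, h4]⟩

theorem sub_of_infty_coe {c a b : Ser} {ρ : ℤ} {y : ℂ} (ha : specialize c ρ a = OnePoint.infty)
    (hb : specialize c ρ b = (y : OnePoint ℂ)) :
    (a - b).order = (a - c).order ∧ (a - b).leadingCoeff = (a - c).leadingCoeff := by
  obtain ⟨h1, h2⟩ := specialize_eq_infty_iff.1 ha
  obtain ⟨h3, -⟩ := specialize_eq_coe_iff.1 hb
  have key : ∀ k < ρ, (a - b).coeff k = (a - c).coeff k := fun k hk => by
    rw [← sub_zero ((a - c).coeff k), ← h3 k hk, ← HahnSeries.coeff_sub, sub_sub_sub_cancel_right]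
  obtain ⟨-, h5, h6⟩ := order_leadingCoeff_of_coeff (x := a - b) (k := (a - c).order)
    (fun j hj => by rw [key j (hj.trans h2), HahnSeries.coeff_eq_zero_of_lt_order hj])
    (by rw [key _ h2]; exact coeff_order_ne_zero h1)
  exact ⟨h5, by rw [h6, key _ h2, HahnSeries.leadingCoeff_eq]⟩

theorem sub_of_coe_infty {c a b : Ser} {ρ : ℤ} {x : ℂ} (ha : specialize c ρ a = (x : OnePoint ℂ))
    (hb : specialize c ρ b = OnePoint.infty) :
    (a - b).order = (b - c).order ∧ (a - b).leadingCoeff = -(b - c).leadingCoeff := by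
  obtain ⟨h1, h2⟩ := sub_of_infty_coe hb ha
  rw [← neg_sub b a, HahnSeries.order_neg, HahnSeries.leadingCoeff_neg, h1, h2]
  exact ⟨rfl, rfl⟩

open scoped Classical in
/-- Up to a constant, the leading coefficients of the differences of a point and of points with a
different common specialization do not depend on the point. -/
theorem exists_leadingCoeff_sub {c a : Ser} {ρ : ℤ} {X : OnePoint ℂ} (ha : specialize c ρ a ≠ X) :
    ∃ l : ℂ, l ≠ 0 ∧ ∀ b, specialize c ρ b = X →
      (a - b).leadingCoeff = l * if X = OnePoint.infty then -(b - c).leadingCoeff else 1 := by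
  induction X using OnePoint.rec with
  | infty =>
    refine ⟨1, one_ne_zero, fun b hb => ?_⟩
    obtain ⟨x, hx⟩ := OnePoint.ne_infty_iff_exists.1 ha
    rw [(sub_of_coe_infty hx.symm hb).2, if_pos rfl, one_mul]
  | coe y =>
    by_cases hinf : specialize c ρ a = OnePoint.infty
    · refine ⟨(a - c).leadingCoeff, HahnSeries.leadingCoeff_ne_zero.2
        (specialize_eq_infty_iff.1 hinf).1, fun b hb => ?_⟩
      rw [(sub_of_infty_coe hinf hb).2, if_neg (OnePoint.coe_ne_infty y), mul_one]
    · obtain ⟨x, hx⟩ := OnePoint.ne_infty_iff_exists.1 hinf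
      have hxy : x ≠ y := by
        rintro rfl
        exact ha hx.symm
      refine ⟨x - y, sub_ne_zero.2 hxy, fun b hb => ?_⟩
      rw [(sub_of_coe_coe hx.symm hb hxy).2, if_neg (OnePoint.coe_ne_infty y), mul_one]

/-! ### Moments of rational curves -/

/-- The area form as an additive map in the second variable. -/
def areaAddHom (u : CoLat) : CoLat →+ ℤ :=
  AddMonoidHom.mk' (area u) fun v w => by
    simp only [area, Prod.fst_add, Prod.snd_add]
    ring

theorem sum_area_eq_zero {E : Type} [Fintype E] {ν : E → CoLat} (hν : ∑ e, ν e = 0) (u : CoLat) :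
    ∑ i, area u (ν i) = 0 := by
  have := map_sum (areaAddHom u) ν Finset.univ
  rw [hν, map_zero] at this
  exact this.symm

theorem area_self (u : CoLat) : area u u = 0 := by
  rw [area]; ring

namespace RealRationalCurve

variable {E : Type} [Fintype E] {ν : E → CoLat} (f : RealRationalCurve E ν)

theorem momentAt_ne_zero_and_order (e : E) : f.momentAt e ≠ 0 ∧ (f.momentAt e).order =
    -(ν e).2 * f.chi₁.order + (ν e).1 * f.chi₂.order
      + ∑ i, area (ν e) (ν i) * (f.pt e - f.pt i).order := by
  obtain ⟨h1, h2⟩ := order_prod_zpow Finset.univ (fun i => f.pt e - f.pt i)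
    (fun i => area (ν e) (ν i)) (fun i _ => by
      -- The factor of the marked point itself is `0 ^ 0 = 1`, because the area of a vector with
      -- itself is zero.
      by_cases h : e = i
      · right; rw [h, area_self]
      · left; exact sub_ne_zero.2 (f.pt_injective.ne h))
  have h3 := zpow_ne_zero (-(ν e).2) f.chi₁_ne
  have h4 := zpow_ne_zero (ν e).1 f.chi₂_ne
  refine ⟨mul_ne_zero (mul_ne_zero h3 h4) h1, ?_⟩
  rw [momentAt, HahnSeries.order_mul (mul_ne_zero h3 h4) h1, HahnSeries.order_mul h3 h4, h2,
    order_zpow f.chi₁_ne, order_zpow f.chi₂_ne]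

theorem momentAt_conj (e : E) : f.momentAt (f.conjE e) = conjSer (f.momentAt e) := by
  rw [← conjSerHom_apply, momentAt, momentAt, map_mul, map_mul, map_zpow₀, map_zpow₀, map_prod,
    conjSerHom_apply, conjSerHom_apply, f.chi₁_real, f.chi₂_real, f.exponent_conj]
  congr 1
  rw [← Equiv.prod_comp f.conjE]
  refine Finset.prod_congr rfl fun i _ => ?_
  rw [map_zpow₀, map_sub, f.exponent_conj, f.pt_conj, f.pt_conj]
  rfl

/-- Seen from `e` or from `e'`, the other marked points lie at one and the same point of the
component. Each leading coefficient is then a constant times a factor that is the same for `e` and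
`e'`. The constant enters with total exponent zero by balancing, and `e`, `e'` themselves have
exponent zero. -/
theorem leadingCoeff_momentAt_eq (hν : ∑ e, ν e = 0) (c : Ser) (ρ : ℤ) {e e' : E}
    (hee : ν e = ν e')
    (hsep : ∀ i, i ≠ e → i ≠ e' → specialize c ρ (f.pt e) ≠ specialize c ρ (f.pt i) ∧
      specialize c ρ (f.pt e') ≠ specialize c ρ (f.pt i))
    (hsame : ∀ i j, i ≠ e → i ≠ e' → j ≠ e → j ≠ e' →
      specialize c ρ (f.pt i) = specialize c ρ (f.pt j)) :
    (f.momentAt e).leadingCoeff = (f.momentAt e').leadingCoeff := by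
  classical
  have hprod : ∏ i, (f.pt e - f.pt i).leadingCoeff ^ area (ν e) (ν i)
      = ∏ i, (f.pt e' - f.pt i).leadingCoeff ^ area (ν e) (ν i) := by
    by_cases hex : ∃ i, i ≠ e ∧ i ≠ e'
    · obtain ⟨i₀, hi₀, hi₀'⟩ := hex
      obtain ⟨l, hl, h⟩ := exists_leadingCoeff_sub (hsep i₀ hi₀ hi₀').1
      obtain ⟨l', hl', h'⟩ := exists_leadingCoeff_sub (hsep i₀ hi₀ hi₀').2
      set g : E → ℂ := fun i => if specialize c ρ (f.pt i₀) = OnePoint.infty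
        then -(f.pt i - c).leadingCoeff else 1 with hg
      have hconst : ∀ m : ℂ, m ≠ 0 → ∏ i, m ^ area (ν e) (ν i) = 1 := by
        intro m hm
        have : ∀ t : Finset E, ∏ i ∈ t, m ^ area (ν e) (ν i) = m ^ ∑ i ∈ t, area (ν e) (ν i) := by
          intro t
          induction t using Finset.induction_on with
          | empty => simp
          | insert a t ha ih => rw [Finset.prod_insert ha, Finset.sum_insert ha, ih, zpow_add₀ hm]
        rw [this, sum_area_eq_zero hν, zpow_zero]
      have key : ∀ (m : ℂ) (x : Ser), m ≠ 0 →
          (∀ b, specialize c ρ b = specialize c ρ (f.pt i₀) → (x - b).leadingCoeff = m *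
            if specialize c ρ (f.pt i₀) = OnePoint.infty then -(b - c).leadingCoeff else 1) →
          ∏ i, (x - f.pt i).leadingCoeff ^ area (ν e) (ν i) = ∏ i, g i ^ area (ν e) (ν i) := by
        intro m x hm hx
        rw [← one_mul (∏ i, g i ^ area (ν e) (ν i)), ← hconst m hm, ← Finset.prod_mul_distrib]
        refine Finset.prod_congr rfl fun i _ => ?_
        by_cases hi : i = e
        · rw [hi, area_self, zpow_zero, zpow_zero, zpow_zero, one_mul]
        by_cases hi' : i = e'
        · rw [hi', ← hee, area_self, zpow_zero, zpow_zero, zpow_zero, one_mul]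
        rw [hx (f.pt i) (hsame i i₀ hi hi' hi₀ hi₀'), mul_zpow]
      rw [key l _ hl h, key l' _ hl' h']
    · push Not at hex
      refine Finset.prod_congr rfl fun i _ => ?_
      have : ν i = ν e := by
        by_cases hi : i = e
        · rw [hi]
        · rw [hex i hi, hee]
      rw [this, area_self, zpow_zero, zpow_zero]
  simp only [← leadingCoeffHom_apply] at hprod ⊢
  rw [momentAt, momentAt, map_mul, map_mul leadingCoeffHom _ (∏ i, _), map_prod, map_prod, ← hee]
  simp only [map_zpow₀]
  rw [hprod]

variable {Γ : ParamCurve E} {σ : RealStructure Γ}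

/-- The tropical moment of an end is the valuation of the moment of the curve. -/
theorem TropicalizesTo.order_momentAt {f : RealRationalCurve E Γ.endSlope}
    (h : f.TropicalizesTo Γ σ) (hsum : ∑ e, Γ.endSlope e = 0) (e : E) :
    ((f.momentAt e).order : ℝ) = Γ.moment e := by
  obtain ⟨c, ρ, hspec, -, hpos, -, -⟩ := h
  set w := Γ.attach e with hw
  have hne : ∀ i, i ≠ e →
      specialize (c w) (ρ w) (f.pt e) ≠ specialize (c w) (ρ w) (f.pt i) := by
    intro i hi heq
    rcases (hspec w e i).1 heq with h | ⟨p, hp⟩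
    · exact hi h.symm
    · exact hp p.start_mem_support
  have hsums : ∑ i, area (Γ.endSlope e) (Γ.endSlope i) * (f.pt e - f.pt i).order
      = ∑ i, area (Γ.endSlope e) (Γ.endSlope i) * ordAlong (c w) (ρ w) (f.pt i) := by
    -- If `e` specializes to infinity, both orders are independent of `i ≠ e` and both sums vanish
    -- by balancing; otherwise the sums agree term by term.
    by_cases hinf : specialize (c w) (ρ w) (f.pt e) = OnePoint.infty
    · have hconst : ∀ (g : E → ℤ) (m : ℤ), (∀ i, i ≠ e → g i = m) →
          ∑ i, area (Γ.endSlope e) (Γ.endSlope i) * g i = 0 := by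
        intro g m hg
        rw [← zero_mul m, ← sum_area_eq_zero hsum (Γ.endSlope e), Finset.sum_mul]
        refine Finset.sum_congr rfl fun i _ => ?_
        by_cases hi : i = e
        · rw [hi, area_self, zero_mul, zero_mul]
        · rw [hg i hi]
      have hfin : ∀ i, i ≠ e →
          ∃ z : ℂ, specialize (c w) (ρ w) (f.pt i) = (z : OnePoint ℂ) := by
        intro i hi
        obtain ⟨z, hz⟩ := OnePoint.ne_infty_iff_exists.1 (hinf ▸ (hne i hi).symm)
        exact ⟨z, hz.symm⟩
      rw [hconst _ (f.pt e - c w).order fun i hi => ?_, hconst _ (ρ w) fun i hi => ?_]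
      · obtain ⟨z, hz⟩ := hfin i hi
        exact ordAlong_of_coe hz
      · obtain ⟨z, hz⟩ := hfin i hi
        exact (sub_of_infty_coe hinf hz).1
    · obtain ⟨x, hx⟩ := OnePoint.ne_infty_iff_exists.1 hinf
      refine Finset.sum_congr rfl fun i _ => ?_
      by_cases hi : i = e
      · rw [hi, area_self, zero_mul, zero_mul]
      congr 1
      by_cases hi' : specialize (c w) (ρ w) (f.pt i) = OnePoint.infty
      · rw [ordAlong_of_infty hi', (sub_of_coe_infty hx.symm hi').1]
      · obtain ⟨y, hy⟩ := OnePoint.ne_infty_iff_exists.1 hi'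
        rw [ordAlong_of_coe hy.symm, (sub_of_coe_coe hx.symm hy.symm ?_).1]
        rintro rfl
        exact hne i hi (hx.symm.trans hy)
  rw [(f.momentAt_ne_zero_and_order e).2, hsums, ParamCurve.moment, ← hw, hpos w]
  simp only [areaR, CoLat.toPlane, Prod.fst_add, Prod.snd_add, Prod.fst_sum, Prod.snd_sum, area,
    Prod.smul_fst, Prod.smul_snd, smul_eq_mul]
  push_cast
  rw [mul_add, mul_add, Finset.mul_sum, Finset.mul_sum]
  have : ∑ i, (((Γ.endSlope e).1 : ℝ) * (Γ.endSlope i).2 - (Γ.endSlope e).2 * (Γ.endSlope i).1)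
      * (ordAlong (c w) (ρ w) (f.pt i) : ℝ)
      = ∑ i, ((Γ.endSlope e).1 : ℝ) * ((ordAlong (c w) (ρ w) (f.pt i) : ℝ) * (Γ.endSlope i).2)
      - ∑ i, ((Γ.endSlope e).2 : ℝ) * ((ordAlong (c w) (ρ w) (f.pt i) : ℝ) * (Γ.endSlope i).1) := by
    rw [← Finset.sum_sub_distrib]
    exact Finset.sum_congr rfl fun i _ => by ring
  rw [this]
  ring

/-- The ends beyond a bounded edge are not two ends with opposite moments. -/
theorem TropicalizesTo.not_beyond_pair {f : RealRationalCurve E Γ.endSlope}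
    (h : f.TropicalizesTo Γ σ) (hsum : ∑ e, Γ.endSlope e = 0) {e e' : E}
    (hslope : Γ.endSlope e = Γ.endSlope e') (hmom : f.momentAt e' = -f.momentAt e)
    {v w : Γ.V} (hvw : Γ.graph.Adj v w) : ¬ ∀ i, i ∈ Γ.beyond v w ↔ i = e ∨ i = e' := by
  intro hA
  obtain ⟨c, ρ, hspec, -⟩ := h
  -- An end attached further away would lie beyond a second edge, which also has at least two ends
  -- beyond it, hence both ends of the pair; the two edges would then bound the same branch.
  have hattach : ∀ i ∈ Γ.beyond v w, Γ.attach i = w := by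
    intro i hi
    by_contra hne
    obtain ⟨u, hwu, hmem⟩ := Γ.isTree.exists_mem_branchSet (Ne.symm hne)
    have huv : u ≠ v := by
      rintro rfl
      exact Γ.isTree.notMem_branchSet_symm hvw (TropCurve.mem_beyond.1 hi) hmem
    have hsub : Γ.beyond w u ⊆ Γ.beyond v w := fun j hj =>
      TropCurve.mem_beyond.2 (Γ.isTree.branchSet_subset hvw hwu huv (TropCurve.mem_beyond.1 hj))
    obtain ⟨a, ha, b, hb, hab⟩ := TropCurve.beyond_nontrivial hwu
    have hall : Γ.beyond v w ⊆ Γ.beyond w u := by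
      intro j hj
      rw [Finset.mem_coe] at ha hb
      rcases (hA a).1 (hsub ha) with rfl | rfl <;> rcases (hA b).1 (hsub hb) with rfl | rfl <;>
        rcases (hA j).1 hj with rfl | rfl <;> first | assumption | exact absurd rfl hab
    exact SimpleGraph.notMem_branchSet_self _ _
      (TropCurve.branchSet_subset_of_beyond_subset hvw hwu hall
        (SimpleGraph.self_mem_branchSet hvw.ne))
  have hsep : ∀ a ∈ Γ.beyond v w, ∀ i, i ≠ a →
      specialize (c w) (ρ w) (f.pt a) ≠ specialize (c w) (ρ w) (f.pt i) := by
    intro a ha i hi heq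
    rcases (hspec w a i).1 heq with h | ⟨p, hp⟩
    · exact hi h.symm
    · exact hp (hattach a ha ▸ p.start_mem_support)
  have hlc := f.leadingCoeff_momentAt_eq hsum (c w) (ρ w) hslope
    (fun i hi hi' => ⟨hsep e ((hA e).2 (Or.inl rfl)) i hi, hsep e' ((hA e').2 (Or.inr rfl)) i hi'⟩)
    (fun i j hi hi' hj hj' => by
      rw [hspec w i j]
      have hmem : ∀ i, i ≠ e → i ≠ e' → Γ.attach i ∈ Γ.graph.branchSet w v := by
        intro i hi hi'
        rw [← TropCurve.mem_beyond, TropCurve.mem_beyond_symm hvw, hA]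
        tauto
      obtain ⟨p, hp⟩ := hmem i hi hi'
      obtain ⟨q, hq⟩ := hmem j hj hj'
      refine Or.inr ⟨p.reverse.append q, ?_⟩
      rw [SimpleGraph.Walk.mem_support_append_iff, SimpleGraph.Walk.support_reverse,
        List.mem_reverse]
      tauto)
  rw [hmom, HahnSeries.leadingCoeff_neg, self_eq_neg, HahnSeries.leadingCoeff_eq_zero] at hlc
  exact (f.momentAt_ne_zero_and_order e).1 hlc

end RealRationalCurve

end

/-! ### Real solutions through a symmetric configuration. -/

noncomputable section

variable {r s : ℕ} {n : Fin r → CoLat} {n₁ : CoLat} {E : Type} [Fintype E] {Γ : ParamCurve E}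
  {Γ₀ : ParamCurve (Fin r ⊕ Fin s)}

/-- An equality would be a relation with coefficients of opposite signs at `i` and `j`. The
multiplicities 1 and 2 are those relating moments of `Γ₀` to valuations on `Γ`. -/
theorem IsGeneric.mul_ne_mul {I : Type} [Fintype I] {d : I → CoLat} {μ : I → ℝ}
    (h : IsGeneric d μ) {i j : I} (hij : i ≠ j) {a b : ℤ} (ha : 0 < a) (hb : 0 < b) (ha2 : a ≤ 2)
    (hb2 : b ≤ 2) : a * μ i ≠ b * μ j := by
  classical
  intro heq
  have hM := totalSize_nonneg d
  have := h (fun x => (if x ∈ ({i} : Finset I) then a else 0)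
    + (if x ∈ ({j} : Finset I) then -b else 0)) (fun x => ?_) ?_ i j
  · simp [hij, hij.symm] at this
    omega
  · have h8 : 8 ≤ 8 * (totalSize d + 1) ^ 2 := by nlinarith
    refine le_trans ?_ h8
    rw [abs_le]
    split_ifs <;> constructor <;> omega
  · simp only [Int.cast_add, add_mul, Finset.sum_add_distrib, ParamCurve.sum_indicator_mul,
      Finset.sum_singleton]
    push_cast
    linarith

/-- Without real ends, balancing and `n₁ ≠ 0` force `s = 0`; but a vertex of `Γ₀` requires ends. -/
theorem realEnds_pos (hsum : (degreeFull s n n₁).sum = 0) (hn₁ : n₁.IsPrimitive)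
    (Γ₀ : ParamCurve (Fin r ⊕ Fin s)) : 0 < r := by
  by_contra hr
  have hr0 : r = 0 := by omega
  subst hr0
  have hs : s = 0 := by
    by_contra hs
    have h2 : (2 * s) • n₁ = 0 := by simpa [degreeFull] using hsum
    have h3 : n₁ = 0 := by
      have h0 : 2 * s ≠ 0 := by omega
      exact (smul_eq_zero.1 h2).resolve_left h0
    obtain ⟨a, b, h⟩ := hn₁
    simp [h3] at h
  subst hs
  obtain ⟨v⟩ := Γ₀.isTree.connected.nonempty
  obtain ⟨b, -⟩ := EndDoubling.Matching.exists_two_branches (Γ₀ := Γ₀) v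
  obtain ⟨e, -⟩ := TropCurve.branchEnds_nonempty b
  exact isEmptyElim e

/-- The ends of the tropicalization of a real curve through a symmetric configuration. -/
theorem exists_endDoubling (hgen : IsGeneric Γ₀.endSlope Γ₀.moment)
    (hdeg : Γ₀.endSlope = degreeS s n n₁) (hsum : (degreeFull s n n₁).sum = 0) {P : SymConfig r s}
    (hP : ∀ i, Γ₀.moment i = P.tropMoment i) {σ : RealStructure Γ}
    (hΓ : Γ.degree = degreeFull s n n₁) {f : RealRationalCurve E Γ.endSlope}
    (hpass : f.PassesThrough n n₁ P) (htrop : f.TropicalizesTo Γ σ) :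
    ∃ D : EndDoubling Γ Γ₀, (∀ j, σ.onE (D.equiv (Sum.inl j)) = D.equiv (Sum.inl j)) ∧
      (∀ k b, σ.onE (D.equiv (Sum.inr (k, b))) = D.equiv (Sum.inr (k, !b))) ∧
      ∀ k, f.momentAt (D.equiv (Sum.inr (k, false))) =
        -f.momentAt (D.equiv (Sum.inr (k, true))) := by
  have hσ : ∀ e, σ.onE e = f.conjE e := by
    obtain ⟨c, ρ, -, -, -, -, h⟩ := htrop
    exact h
  have hsum' : ∑ e, Γ.endSlope e = 0 := by
    rw [← hsum, ← hΓ]; rfl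
  choose eR hR hR' using hpass.1
  choose eI hI hI' using hpass.2
  have hconjR : ∀ j, f.momentAt (f.conjE (eR j)) = f.momentAt (eR j) := by
    intro j
    rw [f.momentAt_conj]
    rcases hR' j with h | h <;> rw [h, ← conjSerHom_apply]
    · rw [conjSerHom_apply, P.re_real]
    · rw [map_neg, conjSerHom_apply, P.re_real]
  have hconjI : ∀ k, f.momentAt (f.conjE (eI k)) = -f.momentAt (eI k) := by
    intro k
    rw [f.momentAt_conj]
    rcases hI' k with h | h <;> rw [h, ← conjSerHom_apply]
    · rw [conjSerHom_apply, P.im_imag]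
    · rw [map_neg, conjSerHom_apply, P.im_imag]
  have hordR : ∀ j, Γ₀.moment (Sum.inl j) = ((f.momentAt (eR j)).order : ℝ) := by
    intro j
    rw [hP]
    rcases hR' j with h | h <;> rw [h]
    · rfl
    · rw [HahnSeries.order_neg]; rfl
  have hordI : ∀ k, Γ₀.moment (Sum.inr k) = 2 * ((f.momentAt (eI k)).order : ℝ) := by
    intro k
    rw [hP]
    rcases hI' k with h | h <;> rw [h]
    · rfl
    · rw [HahnSeries.order_neg]; rfl
  -- For each imaginary condition both the chosen marked point and its conjugate are taken. They
  -- differ, since their moments are opposite and nonzero.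
  let g : Fin r ⊕ Fin s × Bool → E :=
    Sum.elim eR fun p => if p.2 then eI p.1 else f.conjE (eI p.1)
  let mult : Fin r ⊕ Fin s → ℤ := Sum.elim (fun _ => 1) (fun _ => 2)
  let p : Fin r ⊕ Fin s × Bool → Fin r ⊕ Fin s := Sum.map id Prod.fst
  have hord : ∀ x, Γ₀.moment (p x) = mult (p x) * ((f.momentAt (g x)).order : ℝ) := by
    rintro (j | ⟨k, b⟩)
    · simpa [p, mult, g] using hordR j
    · cases b
      · simpa [p, mult, g, hconjI, HahnSeries.order_neg] using hordI k
      · simpa [p, mult, g] using hordI k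
  have hval : ∀ x y, (f.momentAt (g x)).order = (f.momentAt (g y)).order → p x = p y := by
    intro x y hxy
    by_contra hne
    have hm : ∀ i, 0 < mult i ∧ mult i ≤ 2 := by rintro (j | k) <;> simp [mult]
    refine hgen.mul_ne_mul hne (hm (p y)).1 (hm (p x)).1 (hm (p y)).2 (hm (p x)).2 ?_
    rw [hord, hord, hxy]
    ring
  have hinj : Function.Injective g := by
    intro x y hxy
    have hp := hval x y (by rw [hxy])
    rcases x with j | ⟨k, b⟩ <;> rcases y with j' | ⟨k', b'⟩ <;>
      simp only [p, Sum.map_inl, Sum.map_inr, id, Sum.inl.injEq, Sum.inr.injEq, reduceCtorEq] at hp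
    · rw [hp]
    · subst hp
      have hne : f.conjE (eI k) ≠ eI k := by
        intro h
        have h1 := hconjI k
        rw [h] at h1
        have h2 := congrArg HahnSeries.leadingCoeff h1
        rw [HahnSeries.leadingCoeff_neg, self_eq_neg, HahnSeries.leadingCoeff_eq_zero] at h2
        exact (f.momentAt_ne_zero_and_order _).1 h2
      cases b <;> cases b' <;> simp [g, hne, hne.symm] at hxy ⊢
  -- The degree provides exactly `r + 2 * s` ends, so the ends found through the conditions are all
  -- the ends.
  have hcard : Fintype.card (Fin r ⊕ Fin s × Bool) = Fintype.card E := by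
    have h1 := congrArg Multiset.card hΓ
    simp only [ParamCurve.degree, degreeFull, Multiset.card_map, Multiset.card_add,
      Multiset.card_replicate, Finset.card_val, Finset.card_univ, Fintype.card_fin] at h1
    rw [h1, Fintype.card_sum, Fintype.card_prod, Fintype.card_fin, Fintype.card_fin,
      Fintype.card_bool, mul_comm]
  have hbij : Function.Bijective g := (Fintype.bijective_iff_injective_and_card g).2 ⟨hinj, hcard⟩
  refine ⟨⟨Equiv.ofBijective g hbij, fun j => ?_, fun k b => ?_, fun j => ?_, fun k b => ?_⟩,
    fun j => ?_, fun k b => ?_, fun k => ?_⟩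
  · rw [hdeg]
    exact (hR j).symm
  · have h1 : Γ.endSlope (g (Sum.inr (k, b))) = n₁ := by
      cases b
      · exact (f.exponent_conj _).trans (hI k)
      · exact hI k
    rw [hdeg]
    change 2 • n₁ = (2 : ℤ) • Γ.endSlope (g (Sum.inr (k, b)))
    rw [h1, ofNat_zsmul]
  · exact (hordR j).trans (htrop.order_momentAt hsum' _)
  · refine (hord (Sum.inr (k, b))).trans ?_
    rw [htrop.order_momentAt hsum', zsmul_eq_mul]
    rfl
  -- The conjugate end has the same moment, and the valuation of the moment identifies the
  -- condition; hence it is the same end.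
  · obtain ⟨y, hy⟩ := hbij.surjective (f.conjE (eR j))
    have hp := hval y (Sum.inl j) (by rw [hy, hconjR]; rfl)
    rw [hσ]
    change f.conjE (eR j) = eR j
    rcases y with j' | ⟨k, b⟩
    · simp only [p, Sum.map_inl, id, Sum.inl.injEq] at hp
      rw [← hy, hp]; rfl
    · simp [p] at hp
  · cases b
    · have := σ.involE (eI k)
      rw [hσ (eI k)] at this
      exact this
    · exact hσ _
  · exact hconjI k

theorem IsRealSolution.exists_matching (hgen : IsGeneric Γ₀.endSlope Γ₀.moment)
    (hdeg : Γ₀.endSlope = degreeS s n n₁) (hsum : (degreeFull s n n₁).sum = 0) (hr : 0 < r)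
    {P : SymConfig r s} (hP : ∀ i, Γ₀.moment i = P.tropMoment i) {σ : RealStructure Γ}
    (hsol : IsRealSolution n n₁ P Γ₀.image Γ σ) :
    ∃ D : EndDoubling Γ Γ₀, Nonempty D.Matching ∧
      (∀ j, σ.onE (D.equiv (Sum.inl j)) = D.equiv (Sum.inl j)) ∧
      (∀ k b, σ.onE (D.equiv (Sum.inr (k, b))) = D.equiv (Sum.inr (k, !b))) := by
  obtain ⟨hΓ, himage, f, hpass, htrop⟩ := hsol
  obtain ⟨D, h1, h2, h3⟩ := exists_endDoubling hgen hdeg hsum hP hΓ hpass htrop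
  have hsum' : ∑ e, Γ.endSlope e = 0 := by
    rw [← hsum, ← hΓ]; rfl
  refine ⟨D, D.exists_matching (D.sameSplits hgen hdeg hr himage fun v w k hvw hA => ?_), h1, h2⟩
  have hslope : Γ.endSlope (D.equiv (Sum.inr (k, true))) =
      Γ.endSlope (D.equiv (Sum.inr (k, false))) :=
    zsmul_right_injective (two_ne_zero (α := ℤ)) ((D.slope_inr k true).symm.trans (D.slope_inr k false))
  refine htrop.not_beyond_pair hsum' hslope (h3 k) hvw fun i => ?_
  rw [hA, D.proj_eq_inr_iff]

namespace EndDoubling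

variable {D : EndDoubling Γ Γ₀} {σ : RealStructure Γ}

theorem onE_ne_iff (h1 : ∀ j, σ.onE (D.equiv (Sum.inl j)) = D.equiv (Sum.inl j))
    (h2 : ∀ k b, σ.onE (D.equiv (Sum.inr (k, b))) = D.equiv (Sum.inr (k, !b))) (e : E) :
    σ.onE e ≠ e ↔ ∃ k, D.proj e = Sum.inr k := by
  obtain ⟨x, rfl⟩ := D.equiv.surjective e
  rcases x with j | ⟨k, b⟩
  · simp [h1]
  · simp [h2]

theorem proj_onE (h1 : ∀ j, σ.onE (D.equiv (Sum.inl j)) = D.equiv (Sum.inl j))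
    (h2 : ∀ k b, σ.onE (D.equiv (Sum.inr (k, b))) = D.equiv (Sum.inr (k, !b))) (e : E) :
    D.proj (σ.onE e) = D.proj e := by
  obtain ⟨x, rfl⟩ := D.equiv.surjective e
  rcases x with j | ⟨k, b⟩
  · rw [h1]
  · rw [h2, proj_inr, proj_inr]

/-- A curve that is matched with `Γ₀` is obtained by splitting the doubled ends of `Γ₀`. -/
def Matching.splitting (m : D.Matching) (hgen : IsGeneric Γ₀.endSlope Γ₀.moment)
    (h1 : ∀ j, σ.onE (D.equiv (Sum.inl j)) = D.equiv (Sum.inl j))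
    (h2 : ∀ k b, σ.onE (D.equiv (Sum.inr (k, b))) = D.equiv (Sum.inr (k, !b))) :
    Splitting Γ₀ Γ σ where
  projV := m.onV
  projE := D.proj
  surjV := m.onV.surjective
  surjE := D.proj_surjective
  adj v w := (m.adj_iff v w).2
  surjAdj a b h := by
    obtain ⟨v, rfl⟩ := m.onV.surjective a
    obtain ⟨w, rfl⟩ := m.onV.surjective b
    exact ⟨v, w, rfl, rfl, (m.adj_iff v w).1 h⟩
  attach_eq e := (m.attach_eq e).symm
  pos_eq := m.pos_eq hgen
  fibreV v w := by
    rw [m.onV_eq σ (proj_onE h1 h2), or_self, m.onV.injective.eq_iff, eq_comm]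
  fibreE e e' := by
    obtain ⟨x, rfl⟩ := D.equiv.surjective e
    obtain ⟨y, rfl⟩ := D.equiv.surjective e'
    rcases x with j | ⟨k, b⟩ <;> rcases y with j' | ⟨k', b'⟩ <;>
      simp only [h1, h2, proj_inl, proj_inr, EmbeddingLike.apply_eq_iff_eq, Sum.inl.injEq,
        Sum.inr.injEq, reduceCtorEq, Prod.mk.injEq, or_self]
    · exact eq_comm
    · cases b <;> cases b' <;> simp [eq_comm]
  len_eq v w h := by
    rw [if_pos ⟨m.onV_eq σ (proj_onE h1 h2) v, m.onV_eq σ (proj_onE h1 h2) w⟩, one_mul,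
      m.len_eq hgen h]
  endSlope_eq e := by
    obtain ⟨x, rfl⟩ := D.equiv.surjective e
    rcases x with j | ⟨k, b⟩
    · rw [if_pos (h1 j), proj_inl, D.slope_inl, one_smul]
    · rw [if_neg (by simp [h2]), proj_inr, D.slope_inr k b]

theorem Matching.splitting_isMaximal (m : D.Matching) (hgen : IsGeneric Γ₀.endSlope Γ₀.moment)
    (h1 : ∀ j, σ.onE (D.equiv (Sum.inl j)) = D.equiv (Sum.inl j))
    (h2 : ∀ k b, σ.onE (D.equiv (Sum.inr (k, b))) = D.equiv (Sum.inr (k, !b)))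
    (heven : Γ₀.evenGraph = {x | ∃ k, x = Sum.inr (Sum.inr k)}) :
    (m.splitting hgen h1 h2).IsMaximal := by
  rw [Splitting.IsMaximal, heven]
  ext x
  constructor
  · rintro (⟨v, w, -, h, -⟩ | ⟨e, he, rfl⟩)
    -- All vertices are fixed, so no bounded edge is split.
    · exact absurd ⟨m.onV_eq σ (proj_onE h1 h2) v, m.onV_eq σ (proj_onE h1 h2) w⟩ h
    · obtain ⟨k, hk⟩ := (onE_ne_iff h1 h2 e).1 he
      exact ⟨k, congrArg Sum.inr hk⟩
  · rintro ⟨k, rfl⟩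
    refine Or.inr ⟨D.equiv (Sum.inr (k, true)), by simp [h2], ?_⟩
    exact congrArg Sum.inr (D.proj_inr k true).symm

/-- Two curves that are matched with `Γ₀` are isomorphic. -/
def Matching.realIso {E' : Type} [Fintype E'] {Γ' : ParamCurve E'} {σ' : RealStructure Γ'}
    {D' : EndDoubling Γ' Γ₀} (m : D.Matching) (m' : D'.Matching)
    (hgen : IsGeneric Γ₀.endSlope Γ₀.moment)
    (h1 : ∀ j, σ.onE (D.equiv (Sum.inl j)) = D.equiv (Sum.inl j))
    (h2 : ∀ k b, σ.onE (D.equiv (Sum.inr (k, b))) = D.equiv (Sum.inr (k, !b)))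
    (h1' : ∀ j, σ'.onE (D'.equiv (Sum.inl j)) = D'.equiv (Sum.inl j))
    (h2' : ∀ k b, σ'.onE (D'.equiv (Sum.inr (k, b))) = D'.equiv (Sum.inr (k, !b))) :
    RealIso Γ σ Γ' σ' where
  onV := m.onV.trans m'.onV.symm
  onE := D.equiv.symm.trans D'.equiv
  adj_iff v w := by
    rw [← m'.adj_iff, ← m.adj_iff]
    simp
  len_eq v w h := by
    rw [← m.len_eq hgen h, ← m'.len_eq hgen]
    · simp
    · rw [← m'.adj_iff]
      simpa [m.adj_iff] using h
  attach_eq e := by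
    apply m'.onV.injective
    rw [← m'.attach_eq]
    simp only [Equiv.trans_apply, Equiv.apply_symm_apply, ← m.attach_eq]
    simp [proj]
  pos_eq v := by
    rw [← m.pos_eq hgen, ← m'.pos_eq hgen]
    simp
  endSlope_eq e := by
    obtain ⟨x, rfl⟩ := D.equiv.surjective e
    rw [Equiv.trans_apply, Equiv.symm_apply_apply]
    rcases x with j | ⟨k, b⟩
    · rw [← D.slope_inl, ← D'.slope_inl]
    · exact zsmul_right_injective (two_ne_zero (α := ℤ))
        ((D'.slope_inr k b).symm.trans (D.slope_inr k b))
  commV v := by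
    rw [m.onV_eq σ (proj_onE h1 h2), m'.onV_eq σ' (proj_onE h1' h2')]
  commE e := by
    obtain ⟨x, rfl⟩ := D.equiv.surjective e
    rcases x with j | ⟨k, b⟩
    · simp [h1, h1']
    · simp [h2, h2']

end EndDoubling

end

end RealTropical

theorem lemma6p2 (r s : ℕ) (n : Fin r → CoLat) (n₁ : CoLat)
    (hn : ∀ j, (n j).IsPrimitive) (hn₁ : n₁.IsPrimitive)
    (hsum : (degreeFull s n n₁).sum = 0) :
    -- genericity: finitely many proper hyperplanes of the space of moments are to be avoided
    ∃ H : Finset ((Fin r ⊕ Fin s → ℝ) →ₗ[ℝ] ℝ),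
      (∀ φ ∈ H, ∃ μ : Fin r ⊕ Fin s → ℝ, ∑ i, μ i = 0 ∧ φ μ ≠ 0) ∧
      ∀ P : SymConfig r s, (∀ φ ∈ H, φ P.tropMoment ≠ 0) →
      ∀ Γ₀ : ParamCurve (Fin r ⊕ Fin s), Γ₀.endSlope = degreeS s n n₁ →
        (∀ i, Γ₀.moment i = P.tropMoment i) →
        -- the even graph consists of the even ends only
        Γ₀.evenGraph = {x | ∃ k, x = Sum.inr (Sum.inr k)} ∧
        -- at most one real parametrized curve
        (∀ (E E' : Type) [Fintype E] [Fintype E'] (Γ : ParamCurve E) (σ : RealStructure Γ)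
          (Γ' : ParamCurve E') (σ' : RealStructure Γ'),
          IsRealSolution n n₁ P Γ₀.image Γ σ → IsRealSolution n n₁ P Γ₀.image Γ' σ' →
          Nonempty (RealIso Γ σ Γ' σ')) ∧
        -- it is the one with maximal splitting graph
        (∀ (E : Type) [Fintype E] (Γ : ParamCurve E) (σ : RealStructure Γ),
          IsRealSolution n n₁ P Γ₀.image Γ σ →
          (∃ S : Splitting Γ₀ Γ σ, S.IsMaximal ∧
            ∀ e, σ.onE e ≠ e ↔ ∃ k, S.projE e = Sum.inr k) ∧
          (∀ e, σ.onE e ≠ e → Γ.attach (σ.onE e) = Γ.attach e ∧ Γ.valence (Γ.attach e) = 4) ∧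
          ∀ v, ¬ Γ.IsFlat v) := by

  obtain ⟨H, hH, hgenH⟩ := exists_hyperplanes_isGeneric (degreeS s n n₁)
  refine ⟨H, hH, fun P hP Γ₀ hdeg hmom => ?_⟩
  have hgen : IsGeneric Γ₀.endSlope Γ₀.moment := by
    rw [hdeg, show Γ₀.moment = P.tropMoment from funext hmom]
    exact hgenH _ hP
  have hr := realEnds_pos hsum hn₁ Γ₀
  have heven := ParamCurve.evenGraph_eq hgen hdeg hn
  refine ⟨heven, ?_, ?_⟩
  · intro E E' _ _ Γ σ Γ' σ' hsol hsol'
    obtain ⟨D, ⟨m⟩, h1, h2⟩ := hsol.exists_matching hgen hdeg hsum hr hmom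
    obtain ⟨D', ⟨m'⟩, h1', h2'⟩ := hsol'.exists_matching hgen hdeg hsum hr hmom
    exact ⟨m.realIso m' hgen h1 h2 h1' h2'⟩
  · intro E _ Γ σ hsol
    obtain ⟨D, ⟨m⟩, h1, h2⟩ := hsol.exists_matching hgen hdeg hsum hr hmom
    refine ⟨⟨m.splitting hgen h1 h2, m.splitting_isMaximal hgen h1 h2 heven,
      EndDoubling.onE_ne_iff h1 h2⟩, fun e he => ⟨?_, ?_⟩, m.not_isFlat hgen⟩
    · rw [σ.attach_eq, m.onV_eq σ (EndDoubling.proj_onE h1 h2)]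
    · obtain ⟨k, hk⟩ := (EndDoubling.onE_ne_iff h1 h2 e).1 he
      rw [D.proj_eq_inr_iff] at hk
      rcases hk with rfl | rfl <;> exact m.valence_eq_four hgen hdeg k _
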